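/- Let $G$ be a finite tree containing at least one edge, with vertex set $V$ and edge set $E$, and let $p(G)$ be the number of its leaves (vertices of degree one). A metric on $G$ is a function $\ell : E \to (0,\infty)$; put $L(G,\ell)=\sum_{e\in E}\ell(e)$. Identify each edge $e$ with an interval of length $\ell(e)$, and consider the eigenvalue problem $$-f''=\lambda f \ \text{ on each edge},\qquad \sum_{e\sim v} f'(v)=0 \ \text{ at each vertex } v,$$ for real functions $f$ that are continuous on the whole metric graph, where the sum is over the edges $e$ incident to $v$ and the derivatives are taken at $v$ in the direction away from $v$ into $e$. Let $0=\lambda_0(G,\ell)<\lambda_1(G,\ell)\le\lambda_2(G,\ell)\le\cdots$ be its eigenvalues, repeated according to multiplicity. Let $\Lambda_j(G)$ be the smallest number such that $$\lambda_j(G,\ell)\le\frac{\Lambda_j(G)}{L(G,\ell)^2}\qquad\text{for all metrics } \ell \text{ on } G.$$ Then, for every integer $j\ge 1$, $$\Lambda_j(G)=\Big(j-1+\frac{p(G)}{2}\Big)^2\pi^2 .$$ -/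

import Mathlib

namespace QuantumGraph

variable {V : Type*} (G : SimpleGraph V)

/-- A metric on the graph `G`: a positive length for every edge. -/
structure EdgeMetric where
  length : G.edgeSet → ℝ
  length_pos : ∀ e, 0 < length e

variable {G}

namespace EdgeMetric

/-- The length of the edge underlying an oriented edge. -/
def dartLength (ℓ : EdgeMetric G) (d : G.Dart) : ℝ :=
  ℓ.length ⟨d.edge, d.edge_mem⟩

theorem dartLength_pos (ℓ : EdgeMetric G) (d : G.Dart) : 0 < ℓ.dartLength d :=
  ℓ.length_pos _

/-- The total length `L(G, ℓ)`. -/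
noncomputable def totalLength [Fintype G.edgeSet] (ℓ : EdgeMetric G) : ℝ :=
  ∑ e, ℓ.length e

end EdgeMetric

/-- The disjoint union of the intervals `[0, ℓ(d)]`, one for each oriented edge `d`. -/
abbrev PrePoint (ℓ : EdgeMetric G) : Type _ :=
  Σ d : G.Dart, Set.Icc (0 : ℝ) (ℓ.dartLength d)

/-- The gluing of the intervals: the two orientations of an edge parametrize it in opposite
directions, and the initial points of all oriented edges leaving the same vertex are
identified. -/
def Glue (ℓ : EdgeMetric G) (p q : PrePoint ℓ) : Prop :=
  (q.1 = p.1.symm ∧ (q.2 : ℝ) = ℓ.dartLength p.1 - (p.2 : ℝ)) ∨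
  (p.1.fst = q.1.fst ∧ (p.2 : ℝ) = 0 ∧ (q.2 : ℝ) = 0)

/-- The metric graph `(G, ℓ)` as a topological space (with the quotient topology): every edge
is an interval of its length, and intervals are glued together at the vertices. -/
def MetricGraph (ℓ : EdgeMetric G) : Type _ := Quot (Glue ℓ)

instance (ℓ : EdgeMetric G) : TopologicalSpace (MetricGraph ℓ) :=
  inferInstanceAs (TopologicalSpace (Quot (Glue ℓ)))

/-- The point of the metric graph with a given position on an oriented edge. -/
def MetricGraph.mk {ℓ : EdgeMetric G} (p : PrePoint ℓ) : MetricGraph ℓ := Quot.mk (Glue ℓ) p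

/-- The restriction of a function on the metric graph to the oriented edge `d`, in the coordinate
`x ∈ [0, ℓ(d)]` which is the distance from the initial vertex of `d`. (Outside that interval it
is extended by constants; the values there are never used.) -/
noncomputable def onEdge {ℓ : EdgeMetric G} (f : MetricGraph ℓ → ℝ) (d : G.Dart) (x : ℝ) : ℝ :=
  f (MetricGraph.mk ⟨d, Set.projIcc 0 (ℓ.dartLength d) (ℓ.dartLength_pos d).le x⟩)

/-- `f` solves the Neumann eigenvalue problem with parameter `lam`: it is continuous on the metric
graph, `-f'' = lam * f` on every edge, and at every vertex the derivatives of `f` in the directions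
away from the vertex, taken over all oriented edges leaving it, sum to zero. Derivatives at the
ends of an edge are one-sided, and `f'` is the family of derivatives of `f` along the oriented
edges. -/
def SolvesNeumann [Fintype V] [DecidableEq V] [DecidableRel G.Adj] {ℓ : EdgeMetric G}
    (lam : ℝ) (f : MetricGraph ℓ → ℝ) : Prop :=
  Continuous f ∧
  ∃ f' : G.Dart → ℝ → ℝ,
    (∀ d : G.Dart, ∀ x ∈ Set.Icc 0 (ℓ.dartLength d),
      HasDerivWithinAt (onEdge f d) (f' d x) (Set.Icc 0 (ℓ.dartLength d)) x ∧
      HasDerivWithinAt (f' d) (-(lam * onEdge f d x)) (Set.Icc 0 (ℓ.dartLength d)) x) ∧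
    ∀ v : V, ∑ d : G.Dart with d.fst = v, f' d 0 = 0

/-- The space of solutions of the Neumann eigenvalue problem with parameter `lam`; its dimension is
the multiplicity of `lam` as an eigenvalue. -/
def eigenspace [Fintype V] [DecidableEq V] [DecidableRel G.Adj] (ℓ : EdgeMetric G) (lam : ℝ) :
    Submodule ℝ (MetricGraph ℓ → ℝ) where
  carrier := {f | SolvesNeumann lam f}
  zero_mem' := by
    refine ⟨continuous_const, fun _ _ => 0, fun d x _ => ⟨?_, ?_⟩, fun v => by simp⟩
    · exact hasDerivWithinAt_const _ _ (0 : ℝ)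
    · simpa [onEdge] using hasDerivWithinAt_const x (Set.Icc 0 (ℓ.dartLength d)) (0 : ℝ)
  add_mem' := by
    rintro f g ⟨hf, f', hf', hfv⟩ ⟨hg, g', hg', hgv⟩
    refine ⟨hf.add hg, fun d x => f' d x + g' d x, fun d x hx => ⟨?_, ?_⟩, fun v => ?_⟩
    · exact (hf' d x hx).1.add (hg' d x hx).1
    · refine ((hf' d x hx).2.add (hg' d x hx).2).congr_deriv ?_
      simp only [onEdge, Pi.add_apply]
      ring
    · rw [Finset.sum_add_distrib, hfv v, hgv v, add_zero]
  smul_mem' := by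
    rintro c f ⟨hf, f', hf', hfv⟩
    refine ⟨hf.const_smul c, fun d x => c * f' d x, fun d x hx => ⟨?_, ?_⟩, fun v => ?_⟩
    · exact (hf' d x hx).1.const_mul c
    · refine ((hf' d x hx).2.const_mul c).congr_deriv ?_
      simp only [onEdge, Pi.smul_apply, smul_eq_mul]
      ring
    · rw [← Finset.mul_sum, hfv v, mul_zero]

/-- The space spanned by all eigenfunctions with eigenvalue in `S`. As eigenspaces for different
eigenvalues are linearly independent, its dimension is the number of eigenvalues in `S`, counted
with multiplicity. -/
def eigenspan [Fintype V] [DecidableEq V] [DecidableRel G.Adj] (ℓ : EdgeMetric G) (S : Set ℝ) :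
    Submodule ℝ (MetricGraph ℓ → ℝ) :=
  ⨆ lam ∈ S, eigenspace ℓ lam

/-- `t` is the entry with index `j` (starting from `0`) in the nondecreasing list
`λ₀ ≤ λ₁ ≤ λ₂ ≤ …` of all eigenvalues of `(G, ℓ)`, repeated according to multiplicity: at most `j`
eigenvalues are smaller than `t`, and at least `j + 1` eigenvalues are at most `t`. -/
def IsEigenvalueAt [Fintype V] [DecidableEq V] [DecidableRel G.Adj] (ℓ : EdgeMetric G)
    (j : ℕ) (t : ℝ) : Prop :=
  Module.rank ℝ (eigenspan ℓ (Set.Iio t)) ≤ (j : Cardinal) ∧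
  ((j + 1 : ℕ) : Cardinal) ≤ Module.rank ℝ (eigenspan ℓ (Set.Iic t))

/-- The eigenvalue with index `j` is uniquely determined. -/
theorem IsEigenvalueAt.unique [Fintype V] [DecidableEq V] [DecidableRel G.Adj] {ℓ : EdgeMetric G}
    {j : ℕ} {s t : ℝ} (hs : IsEigenvalueAt ℓ j s) (ht : IsEigenvalueAt ℓ j t) : s = t := by
  have key : ∀ {a b : ℝ}, IsEigenvalueAt ℓ j a → IsEigenvalueAt ℓ j b → ¬ a < b := by
    intro a b ha hb hab
    have hle : eigenspan ℓ (Set.Iic a) ≤ eigenspan ℓ (Set.Iio b) :=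
      biSup_mono fun _ hx => lt_of_le_of_lt hx hab
    have h : ((j + 1 : ℕ) : Cardinal) ≤ (j : Cardinal) :=
      (ha.2.trans (Submodule.rank_mono hle)).trans hb.1
    have h' : j + 1 ≤ j := Nat.cast_le.mp h
    omega
  exact le_antisymm (not_lt.mp (key ht hs)) (not_lt.mp (key hs ht))

/-- `C` is the number `Λ_j(G)`: the smallest number such that, for all metrics `ℓ` on `G`, the
eigenvalue `λ_j(G, ℓ)` (which exists) is at most `C / L(G, ℓ)²`. -/
def IsSharpUpperConstant [Fintype V] [DecidableEq V] (G : SimpleGraph V) [DecidableRel G.Adj]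
    (j : ℕ) (C : ℝ) : Prop :=
  IsLeast {c : ℝ | ∀ ℓ : EdgeMetric G, ∃ t : ℝ, IsEigenvalueAt ℓ j t ∧ t ≤ c / ℓ.totalLength ^ 2} C

/-- The number `p(G)` of pendant vertices (leaves), i.e. vertices of degree one. -/
def leafCount [Fintype V] (G : SimpleGraph V) [DecidableRel G.Adj] : ℕ :=
  (Finset.univ.filter fun v : V => G.degree v = 1).card

end QuantumGraph

/-! Upper bound. Root the tree at a leaf, put K = (j - 1 + p/2)π / L, and cut the edges into pieces
of length h with K h < π. For 0 ≤ k ≤ K a solution of -f'' = k² f on a piece is determined by its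
end values, so the vertex conditions become T(k) x = 0 for a symmetric matrix T(k) acting on nodal
values (`treeOperator`), with quadratic form ∫ f'² - k² f² of the interpolating solution. T(0) is
nonnegative. If T(K) is nonpositive on a subspace of dimension j + 1, then j + 1 eigenvalue branches
of T(k) reach zero on [0, K] (`exists_finset_finrank_le_sum_finrank_ker`). The kernels met there
inject into the eigenspaces for k² ≤ K², which are independent (`sum_finrank_le_rank_eigenspan`).

The subspace comes from Prüfer angles carried from the leaves to the root
(`exists_nonpos_subspace`). A piece adds its angle K h. A piece on which the angle passes π/2 leaves
a direction free; every other piece costs one linear condition. Where c branches meet, tangents add,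
and since arctan x + arctan y ≤ arctan (x + y) + π/2 at most (c - 1)π/2 is lost. The numbers c - 1
sum to p - 2, so total angle (j + (p - 2)/2)π = (j - 1 + p/2)π suffices.

Sharpness. For σ < 1 take pendant edges of length π/2, the root edge longer by a multiple of π, and
tiny inner edges (`exists_metric_rank_le`). Functions vanishing at j chosen points of the root edge
have energy at least σ² times their mass, so evaluation at these points is injective on the span of
the eigenfunctions below σ², and at most j eigenvalues lie there. The energy estimate completes a
square against y = σ cot(σ x + η), a solution of y' = -σ² - y² (`riccati_le_integral`); the phases η
are chosen so that the boundary terms have the right sign at every vertex (`exists_phase`).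

That the eigenvalue of index j exists at all follows from finite-dimensionality of the spans below
any bound (`exists_isEigenvalueAt`). -/

/-! ### Min-max, perturbation and zero crossings of eigenvalues of symmetric operators. -/

namespace LinearMap.IsSymmetric

open Module

variable {E : Type*} [NormedAddCommGroup E] [InnerProductSpace ℝ E] [FiniteDimensional ℝ E]
  {n : ℕ}

theorem inner_apply_self_eq_sum {A : E →ₗ[ℝ] E} (hA : A.IsSymmetric) (hn : finrank ℝ E = n)
    (x : E) : inner ℝ (A x) x =
      ∑ i, hA.eigenvalues hn i * (inner ℝ (hA.eigenvectorBasis hn i) x) ^ 2 := by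
  rw [← (hA.eigenvectorBasis hn).sum_inner_mul_inner (A x) x]
  refine Finset.sum_congr rfl fun i _ => ?_
  rw [hA x, hA.apply_eigenvectorBasis hn i, real_inner_smul_right, real_inner_comm]
  simp only [RCLike.ofReal_real_eq_id, id_eq]
  ring

theorem norm_sq_eq_sum {A : E →ₗ[ℝ] E} (hA : A.IsSymmetric) (hn : finrank ℝ E = n)
    (x : E) : ‖x‖ ^ 2 = ∑ i, (inner ℝ (hA.eigenvectorBasis hn i) x) ^ 2 := by
  rw [← (hA.eigenvectorBasis hn).sum_sq_norm_inner_right x]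
  simp

/-- A subspace of dimension larger than the cardinality of `s` has a nonzero vector whose
coordinates in `s` vanish. -/
theorem exists_mem_coord_eq_zero {A : E →ₗ[ℝ] E} (hA : A.IsSymmetric) (hn : finrank ℝ E = n)
    (U : Submodule ℝ E) (s : Finset (Fin n)) (hs : s.card < finrank ℝ U) :
    ∃ x ∈ U, x ≠ 0 ∧ ∀ i ∈ s, inner ℝ (hA.eigenvectorBasis hn i) x = 0 := by
  let φ : U →ₗ[ℝ] (s → ℝ) :=
    LinearMap.pi fun i => ((innerSL ℝ (hA.eigenvectorBasis hn i)).toLinearMap ∘ₗ U.subtype)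
  have hφ : LinearMap.ker φ ≠ ⊥ := by
    apply LinearMap.ker_ne_bot_of_finrank_lt
    simpa using hs
  obtain ⟨x, hx, hx0⟩ := (Submodule.ne_bot_iff _).1 hφ
  refine ⟨x, x.2, by simpa using hx0, fun i hi => ?_⟩
  have := congrFun (LinearMap.mem_ker.1 hx) ⟨i, hi⟩
  simpa [φ] using this

/-- Eigenvalues are in decreasing order, so only n - 1 - i eigenvectors come after index i. Some
nonzero vector of U is orthogonal to all of them, and on it the form is at least the eigenvalue of
index i times the squared norm. -/
theorem eigenvalues_le_of_form_le {A : E →ₗ[ℝ] E} (hA : A.IsSymmetric) (hn : finrank ℝ E = n)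
    (i : Fin n) (U : Submodule ℝ E) (hU : n - i ≤ finrank ℝ U) {c : ℝ}
    (h : ∀ x ∈ U, inner ℝ (A x) x ≤ c * ‖x‖ ^ 2) : hA.eigenvalues hn i ≤ c := by
  obtain ⟨x, hx, hx0, hxs⟩ := hA.exists_mem_coord_eq_zero hn U (Finset.Ioi i) (by
    rw [Fin.card_Ioi]; have := i.2; omega)
  have h1 := h x hx
  have h2 : hA.eigenvalues hn i * ‖x‖ ^ 2 ≤ inner ℝ (A x) x := by
    rw [hA.inner_apply_self_eq_sum hn, hA.norm_sq_eq_sum hn, Finset.mul_sum]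
    refine Finset.sum_le_sum fun k _ => ?_
    rcases lt_or_ge i k with hk | hk
    · simp [hxs k (Finset.mem_Ioi.2 hk)]
    · exact mul_le_mul_of_nonneg_right (hA.eigenvalues_antitone hn hk) (sq_nonneg _)
  have h3 : 0 < ‖x‖ ^ 2 := by positivity
  exact le_of_mul_le_mul_right (h2.trans h1) h3

/-- Weyl's inequality, by min-max with the span of the eigenvectors of B from index i on. With ε the
operator norm of a difference it makes eigenvalue branches continuous. -/
theorem eigenvalues_le_add_of_form_le {A B : E →ₗ[ℝ] E} (hA : A.IsSymmetric) (hB : B.IsSymmetric)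
    (hn : finrank ℝ E = n) {ε : ℝ} (h : ∀ x, inner ℝ (A x) x ≤ inner ℝ (B x) x + ε * ‖x‖ ^ 2)
    (i : Fin n) : hA.eigenvalues hn i ≤ hB.eigenvalues hn i + ε := by
  let b := hB.eigenvectorBasis hn
  let W := Submodule.span ℝ (Set.range fun k : Finset.Ici i => b k)
  have hW : finrank ℝ W = n - i := by
    rw [finrank_span_eq_card]
    · rw [Fintype.card_coe, Fin.card_Ici]
    · exact b.orthonormal.linearIndependent.comp _ Subtype.val_injective
  refine hA.eigenvalues_le_of_form_le hn i W hW.ge fun x hx => (h x).trans ?_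
  have hx0 : ∀ k, k < i → inner ℝ (b k) x = 0 := by
    intro k hk
    refine Submodule.span_induction (p := fun y _ => inner ℝ (b k) y = 0) ?_ (by simp) ?_ ?_ hx
    · rintro _ ⟨l, rfl⟩
      have : k ≠ l := by
        rintro rfl
        exact absurd (Finset.mem_Ici.1 l.2) (not_le.2 hk)
      simpa using b.orthonormal.2 this
    · intro y z _ _ hy hz
      rw [inner_add_right, hy, hz, add_zero]
    · intro a y _ hy
      rw [real_inner_smul_right, hy, mul_zero]
  rw [add_mul]
  gcongr
  rw [hB.inner_apply_self_eq_sum hn, hB.norm_sq_eq_sum hn, Finset.mul_sum]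
  refine Finset.sum_le_sum fun k _ => ?_
  rcases lt_or_ge k i with hk | hk
  · have := hx0 k hk
    simp only [b] at this
    simp [this]
  · exact mul_le_mul_of_nonneg_right (hB.eigenvalues_antitone hn hk) (sq_nonneg _)

end LinearMap.IsSymmetric

open Module in
/-- Along a continuous path of symmetric operators that starts at a nonnegative operator, the
kernels have at least the dimension of any subspace on which the end point is nonpositive. -/
theorem exists_finset_finrank_le_sum_finrank_ker {E : Type*} [NormedAddCommGroup E]
    [InnerProductSpace ℝ E] [FiniteDimensional ℝ E] (T : ℝ → E →L[ℝ] E) {K : ℝ} (hK : 0 ≤ K)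
    (hT : ContinuousOn T (Set.Icc 0 K)) (hsym : ∀ k, (T k : E →ₗ[ℝ] E).IsSymmetric)
    (h0 : ∀ x, 0 ≤ inner ℝ (T 0 x) x) (U : Submodule ℝ E)
    (hU : ∀ x ∈ U, inner ℝ (T K x) x ≤ 0) :
    ∃ S : Finset ℝ, (∀ k ∈ S, k ∈ Set.Icc 0 K) ∧
      finrank ℝ U ≤ ∑ k ∈ S, finrank ℝ (LinearMap.ker (T k : E →ₗ[ℝ] E)) := by
  classical
  obtain ⟨n, hn⟩ : ∃ n, finrank ℝ E = n := ⟨_, rfl⟩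
  let e : Fin n → ℝ → ℝ := fun i k => (hsym k).eigenvalues hn i
  have hdist : ∀ i k k', e i k - e i k' ≤ ‖T k - T k'‖ := by
    intro i k k'
    have := (hsym k).eigenvalues_le_add_of_form_le (hsym k') hn (ε := ‖T k - T k'‖) (fun x => by
      have h1 : inner ℝ ((T k - T k') x) x ≤ ‖(T k - T k') x‖ * ‖x‖ := real_inner_le_norm _ _
      have h2 := (T k - T k').le_opNorm x
      have h3 : inner ℝ ((T k - T k') x) x = inner ℝ (T k x) x - inner ℝ (T k' x) x := by
        rw [sub_apply, inner_sub_left]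
      have h4 : ‖(T k - T k') x‖ * ‖x‖ ≤ ‖T k - T k'‖ * ‖x‖ * ‖x‖ := by gcongr
      simp only [ContinuousLinearMap.coe_coe]
      nlinarith) i
    simp only [e]
    linarith
  have hcont : ∀ i, ContinuousOn (e i) (Set.Icc 0 K) := by
    intro i
    rw [Metric.continuousOn_iff] at hT ⊢
    intro b hb ε hε
    obtain ⟨δ, hδ, h⟩ := hT b hb ε hε
    refine ⟨δ, hδ, fun a ha hab => lt_of_le_of_lt ?_ (h a ha hab)⟩
    rw [Real.dist_eq, dist_eq_norm, abs_le]
    have h1 := hdist i a b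
    have h2 := hdist i b a
    rw [norm_sub_rev] at h2
    constructor <;> linarith
  have hzero : ∀ i : Fin n, n - i ≤ finrank ℝ U → ∃ k ∈ Set.Icc 0 K, e i k = 0 := by
    intro i hi
    have hK0 : e i K ≤ 0 := (hsym K).eigenvalues_le_of_form_le hn i U hi fun x hx => by
      simpa using hU x hx
    have h00 : 0 ≤ e i 0 := by
      have hx := (hsym 0).apply_eigenvectorBasis hn i
      have h2 := h0 ((hsym 0).eigenvectorBasis hn i)
      simp only [ContinuousLinearMap.coe_coe] at hx
      rw [hx] at h2
      simpa [real_inner_smul_left] using h2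
    exact intermediate_value_Icc' hK (hcont i) ⟨hK0, h00⟩
  choose! z hz hz0 using hzero
  -- These are the lowest `finrank ℝ U` branches, each of which has a zero. Branches sharing a zero
  -- k are bounded by the multiplicity of 0 as an eigenvalue of T k.
  let I : Finset (Fin n) := Finset.univ.filter fun i : Fin n => n - i ≤ finrank ℝ U
  refine ⟨I.image z, ?_, ?_⟩
  · intro k hk
    obtain ⟨i, hi, rfl⟩ := Finset.mem_image.1 hk
    exact hz i (by simpa [I] using hi)
  · have hUn : finrank ℝ U ≤ n := hn ▸ Submodule.finrank_le U
    have hI : finrank ℝ U = I.card := by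
      rcases Nat.eq_zero_or_pos (finrank ℝ U) with h | h
      · rw [h, eq_comm, Finset.card_eq_zero, Finset.filter_eq_empty_iff]
        intro i _
        have := i.2
        omega
      · have hI' : I = Finset.Ici ⟨n - finrank ℝ U, by omega⟩ := by
          ext i
          simp only [I, Finset.mem_filter, Finset.mem_univ, true_and, Finset.mem_Ici, Fin.le_def]
          omega
        rw [hI', Fin.card_Ici]
        simp only
        omega
    rw [hI, Finset.card_eq_sum_card_image z I]
    refine Finset.sum_le_sum fun k _ => ?_
    have hc := (hsym k).card_filter_eigenvalues_eq hn (0 : ℝ)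
    rw [← End.eigenspace_zero, ← hc]
    refine Finset.card_le_card fun i hi => ?_
    simp only [Finset.mem_filter, I, Finset.mem_univ, true_and] at hi ⊢
    have := hz0 i hi.1
    rw [hi.2] at this
    simpa using this

/-! ### Prüfer angles on a rooted tree and the nonpositive subspace. -/

namespace QuantumGraph

open Real

/-- Completion of the square around a cosine profile whose phase runs from α at the end with value x
to α + θ at the end with value p. The sign of the remainder is that of cos (α + θ) when the other
factors are positive. -/
theorem edge_form_add_tan {α θ : ℝ} (hα : cos α ≠ 0) (hθ : sin θ ≠ 0) (hD : cos (α + θ) ≠ 0)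
    (x p : ℝ) : -(tan α * x ^ 2) + ((x ^ 2 + p ^ 2) * cos θ - 2 * x * p) / sin θ
      + tan (α + θ) * p ^ 2
      = cos (α + θ) / (sin θ * cos α) * (x - cos α / cos (α + θ) * p) ^ 2 := by
  rw [tan_eq_sin_div_cos, tan_eq_sin_div_cos, sin_add]
  rw [cos_add] at hD ⊢
  have h1 := sin_sq_add_cos_sq θ
  field_simp
  have h2 : sin θ ^ 2 = 1 - cos θ ^ 2 := by linarith
  ring_nf
  simp only [h2]
  ring

/-- A Prüfer angle in `[-π/2, 3π/2)`, reduced modulo `π` to `[-π/2, π/2)`. -/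
noncomputable def wrapAngle (x : ℝ) : ℝ := if π / 2 ≤ x then x - π else x

/-- Before π/2 the remainder in `edge_form_add_tan` is nonnegative and `h1` annihilates it; beyond
π/2 it is nonpositive and costs no condition. The angle -π/2 encodes a zero value, so the value of
`tan` there is immaterial. -/
theorem edge_form_le {α θ : ℝ} (hα : -(π / 2) ≤ α) (hα' : α < π / 2) (hθ : 0 < θ) (hθ' : θ < π)
    {x p : ℝ} (h1 : α + θ < π / 2 → x * cos (α + θ) = cos α * p)
    (h2 : wrapAngle (α + θ) = -(π / 2) → p = 0) :
    ((x ^ 2 + p ^ 2) * cos θ - 2 * x * p) / sin θ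
      ≤ tan α * x ^ 2 - tan (wrapAngle (α + θ)) * p ^ 2 := by
  have hs : 0 < sin θ := sin_pos_of_pos_of_lt_pi hθ hθ'
  rcases hα.eq_or_lt with hα0 | hα0
  · subst hα0
    have hlt : -(π / 2) + θ < π / 2 := by linarith
    have hc : cos (-(π / 2) + θ) = sin θ := by
      rw [add_comm, ← sub_eq_add_neg, cos_sub_pi_div_two]
    have hx : x = 0 := by
      have := h1 hlt
      rw [hc, cos_neg, cos_pi_div_two, zero_mul] at this
      exact (mul_eq_zero.1 this).resolve_right hs.ne'
    have hs' : sin (-(π / 2) + θ) = - cos θ := by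
      rw [add_comm, ← sub_eq_add_neg, sin_sub_pi_div_two]
    rw [wrapAngle, if_neg (not_le.2 hlt), tan_eq_sin_div_cos (_ + _), hc, hs', hx]
    apply le_of_eq
    field_simp
    ring
  · have ha : 0 < cos α := cos_pos_of_mem_Ioo ⟨hα0, hα'⟩
    rcases lt_trichotomy (α + θ) (π / 2) with h | h | h
    · have hD : 0 < cos (α + θ) := cos_pos_of_mem_Ioo ⟨by linarith, h⟩
      have := edge_form_add_tan ha.ne' hs.ne' hD.ne' x p
      rw [wrapAngle, if_neg (not_le.2 h)]
      have hx : x - cos α / cos (α + θ) * p = 0 := by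
        rw [sub_eq_zero, div_mul_eq_mul_div, eq_div_iff hD.ne']
        exact h1 h
      rw [hx] at this
      nlinarith
    · have hp : p = 0 := h2 (by rw [wrapAngle, if_pos h.ge, h]; ring)
      have hθe : θ = π / 2 - α := by linarith
      rw [hp, hθe, cos_pi_div_two_sub, sin_pi_div_two_sub, tan_eq_sin_div_cos]
      apply le_of_eq
      field_simp
      ring
    · have hD : cos (α + θ) < 0 := cos_neg_of_pi_div_two_lt_of_lt h (by linarith)
      have := edge_form_add_tan ha.ne' hs.ne' hD.ne x p
      rw [wrapAngle, if_pos h.le, tan_sub_pi]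
      have h3 : cos (α + θ) / (sin θ * cos α) * (x - cos α / cos (α + θ) * p) ^ 2 ≤ 0 :=
        mul_nonpos_of_nonpos_of_nonneg
          (div_nonpos_of_nonpos_of_nonneg hD.le (by positivity)) (sq_nonneg _)
      linarith

/-- The loss of angle when two branches meet, and the source of p/2 in the constant. It is
approached when x and y both tend to +∞. -/
theorem arctan_add_arctan_le (x y : ℝ) : arctan x + arctan y ≤ arctan (x + y) + π / 2 := by
  have hx := arctan_lt_pi_div_two x
  have hy := arctan_lt_pi_div_two y
  rcases le_or_gt 0 y with h | h
  · have : arctan x ≤ arctan (x + y) := arctan_strictMono.monotone (by linarith)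
    linarith
  rcases le_or_gt 0 x with h' | h'
  · have : arctan y ≤ arctan (x + y) := arctan_strictMono.monotone (by linarith)
    linarith
  · have h1 : arctan x < 0 := arctan_lt_zero.2 h'
    have h2 : arctan y < 0 := arctan_lt_zero.2 h
    have := neg_pi_div_two_lt_arctan (x + y)
    linarith

theorem sum_arctan_le {ι : Type*} {s : Finset ι} (hs : s.Nonempty) (t : ι → ℝ) :
    ∑ i ∈ s, arctan (t i) ≤ arctan (∑ i ∈ s, t i) + (s.card - 1) * (π / 2) := by
  induction hs using Finset.Nonempty.cons_induction with
  | singleton a => simp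
  | cons a s ha hs ih =>
    rw [Finset.sum_cons, Finset.sum_cons, Finset.card_cons]
    have := arctan_add_arctan_le (t a) (∑ i ∈ s, t i)
    push_cast
    linarith

theorem wrapAngle_mem {x : ℝ} (h : -(π / 2) ≤ x) (h' : x < 3 * π / 2) :
    -(π / 2) ≤ wrapAngle x ∧ wrapAngle x < π / 2 := by
  unfold wrapAngle
  split_ifs with hx
  · constructor <;> linarith
  · exact ⟨h, not_le.1 hx⟩

/-- Well-founded recursion as a fixed-point equation: by `hF` only predecessors matter, so the
arbitrary value used elsewhere is harmless. -/
theorem exists_fix_of_wellFounded {W X : Type*} [Nonempty X] {r : W → W → Prop}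
    (wf : WellFounded r) (F : W → (W → X) → X)
    (hF : ∀ w g g', (∀ c, r c w → g c = g' c) → F w g = F w g') :
    ∃ f : W → X, ∀ w, f w = F w f := by
  classical
  refine ⟨wf.fix fun w ih => F w fun c => if h : r c w then ih c h else Classical.arbitrary X,
    fun w => ?_⟩
  rw [wf.fix_eq]
  refine hF _ _ _ fun c hc => ?_
  rw [dif_pos hc]

section Inertia

variable {I : Type*} [Fintype I] [DecidableEq I]

open Classical in
/-- The Prüfer angle at a node of a rooted tree, from the angles arriving from its children. -/
noncomputable def mergeAngle (par : I → Option I) (β : I → ℝ) (w : Option I) : ℝ :=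
  -- One child forcing a zero at the node forces it for the node itself. A leaf has an empty sum,
  -- hence angle 0, which is the Neumann condition.
  if ∃ i, par i = w ∧ β i = -(π / 2) then -(π / 2)
  else arctan (∑ i with par i = w, tan (β i))

theorem mergeAngle_mem (par : I → Option I) (β : I → ℝ) (w : Option I) :
    -(π / 2) ≤ mergeAngle par β w ∧ mergeAngle par β w < π / 2 := by
  unfold mergeAngle
  split_ifs
  · exact ⟨le_rfl, by linarith [pi_pos]⟩
  · exact ⟨(neg_pi_div_two_lt_arctan _).le, arctan_lt_pi_div_two _⟩

/-- If a child arrives with -π/2, it already supplies the merged angle and the others contribute at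
most π/2 each. Otherwise this is `sum_arctan_le`. -/
theorem sum_le_mergeAngle {par : I → Option I} {β : I → ℝ}
    (hβ : ∀ i, -(π / 2) ≤ β i ∧ β i < π / 2) {w : Option I} (hw : ∃ i, par i = w) :
    ∑ i with par i = w, β i ≤ mergeAngle par β w
      + (((Finset.univ.filter fun i => par i = w).card : ℝ) - 1) * (π / 2) := by
  unfold mergeAngle
  split_ifs with h
  · obtain ⟨i, hi, hβi⟩ := h
    have hi' : i ∈ Finset.univ.filter fun i => par i = w := by simpa using hi
    rw [← Finset.add_sum_erase _ _ hi', hβi]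
    have h1 : ∑ c ∈ (Finset.univ.filter fun i => par i = w).erase i, β c
        ≤ ((Finset.univ.filter fun i => par i = w).erase i).card • (π / 2) :=
      Finset.sum_le_card_nsmul _ _ _ fun c _ => (hβ c).2.le
    rw [Finset.card_erase_of_mem hi', nsmul_eq_mul,
      Nat.cast_sub (Finset.card_pos.2 ⟨i, hi'⟩), Nat.cast_one] at h1
    linarith
  · push Not at h
    obtain ⟨i, hi⟩ := hw
    have := sum_arctan_le (s := Finset.univ.filter fun i => par i = w) ⟨i, by simpa using hi⟩
      fun i => tan (β i)
    refine le_trans (le_of_eq (Finset.sum_congr rfl fun c hc => ?_)) this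
    have hc' : par c = w := by simpa using hc
    rw [arctan_tan (lt_of_le_of_ne (hβ c).1 (Ne.symm (h c hc'))) (hβ c).2]

theorem exists_angles {par : I → Option I}
    (hwf : WellFounded fun c w : Option I => ∃ i, c = some i ∧ par i = w) (θ : I → ℝ) :
    ∃ α : Option I → ℝ,
      ∀ w, α w = mergeAngle par (fun i => wrapAngle (α (some i) + θ i)) w := by
  refine exists_fix_of_wellFounded hwf
    (fun w α => mergeAngle par (fun i => wrapAngle (α (some i) + θ i)) w) fun w g g' h => ?_
  unfold mergeAngle
  have h1 : ∀ i, par i = w → g (some i) = g' (some i) := fun i hi => h _ ⟨i, rfl, hi⟩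
  have h2 : (∃ i, par i = w ∧ wrapAngle (g (some i) + θ i) = -(π / 2)) ↔
      ∃ i, par i = w ∧ wrapAngle (g' (some i) + θ i) = -(π / 2) :=
    exists_congr fun i => and_congr_right fun hi => by rw [h1 i hi]
  simp only [h2]
  congr 2
  refine Finset.sum_congr rfl fun i hi => ?_
  rw [h1 i (by simpa using hi)]

/-- Pure counting: the numbers of children sum to |I|, while |I| + 1 nodes split into leaves and
nodes with children, the root being among the latter. -/
theorem card_children_sum (par : I → Option I) (hroot : ∃ i, par i = none) :
    ∑ w : Option I with (∃ i, par i = w),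
      (((Finset.univ.filter fun i => par i = w).card : ℝ) - 1)
      = ((Finset.univ.filter fun i : I => ∀ c, par c ≠ some i).card : ℝ) - 1 := by
  have h1 : ∑ w : Option I with (∃ i, par i = w),
      ((Finset.univ.filter fun i => par i = w).card : ℝ) = Fintype.card I := by
    rw [← Nat.cast_sum]
    congr 1
    rw [Finset.sum_filter_of_ne]
    · exact (Finset.card_eq_sum_card_fiberwise (f := par) (s := Finset.univ) (t := Finset.univ)
        (fun _ _ => by simp)).symm
    · intro w _ hw
      obtain ⟨i, hi⟩ := Finset.card_pos.1 (Nat.pos_of_ne_zero hw)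
      exact ⟨i, by simpa using hi⟩
  have h2 : (Finset.univ.filter fun w : Option I => ∃ i, par i = w).card
      + (Finset.univ.filter fun i : I => ∀ c, par c ≠ some i).card = Fintype.card I + 1 := by
    rw [← Fintype.card_option, ← Finset.card_univ (α := Option I),
      ← Finset.card_filter_add_card_filter_not (s := Finset.univ)
        (fun w : Option I => ∃ i, par i = w)]
    congr 1
    refine Finset.card_bij (fun i _ => some i) ?_ ?_ ?_
    · intro i hi
      simpa using hi
    · intro a _ b _ h
      exact Option.some_injective _ h
    · intro w hw
      simp only [Finset.mem_filter, Finset.mem_univ, true_and, not_exists] at hw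
      rcases w with _ | i
      · obtain ⟨i, hi⟩ := hroot
        exact absurd hi (hw i)
      · exact ⟨i, by simpa using hw, rfl⟩
  rw [Finset.sum_sub_distrib, h1, Finset.sum_const, nsmul_one]
  have h3 := congrArg (Nat.cast (R := ℝ)) h2
  push_cast at h3
  linarith

/-- The form of the eigenvalue problem on a rooted tree with short edges is nonpositive on a
large subspace: the total Prüfer angle is distributed over the sign changes along the edges, and
at most `π / 2` is lost at every merging of two branches. -/
theorem exists_nonpos_subspace {par : I → Option I}
    (hwf : WellFounded fun c w : Option I => ∃ i, c = some i ∧ par i = w)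
    (hroot : ∃ i, par i = none) {θ : I → ℝ} (hθ : ∀ i, 0 < θ i ∧ θ i < π) (j : ℕ)
    (hsum : (j + (((Finset.univ.filter fun i : I => ∀ c, par c ≠ some i).card : ℝ) - 1) / 2) * π
      ≤ ∑ i, θ i) :
    ∃ U : Submodule ℝ (EuclideanSpace ℝ (Option I)), j + 1 ≤ Module.finrank ℝ U ∧
      ∀ x ∈ U, ∑ i, ((x (some i) ^ 2 + x (par i) ^ 2) * cos (θ i)
        - 2 * x (some i) * x (par i)) / sin (θ i) ≤ 0 := by
  classical
  obtain ⟨α, hα⟩ := exists_angles hwf θ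
  set β : I → ℝ := fun i => wrapAngle (α (some i) + θ i) with hβdef
  have hαm : ∀ w, -(π / 2) ≤ α w ∧ α w < π / 2 := fun w => by
    rw [hα w]; exact mergeAngle_mem _ _ _
  have hβ : ∀ i, -(π / 2) ≤ β i ∧ β i < π / 2 := fun i =>
    wrapAngle_mem (by linarith [(hαm (some i)).1, (hθ i).1])
      (by linarith [(hαm (some i)).2, (hθ i).2])
  -- Edges on which the angle reaches π/2: each absorbs π of the total angle and leaves a direction
  -- free.
  let cross : Finset I := Finset.univ.filter fun i => π / 2 ≤ α (some i) + θ i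
  have hang : ∑ i, θ i = cross.card * π + ∑ i, β i - ∑ i, α (some i) := by
    have h1 : ∀ i, θ i = (if π / 2 ≤ α (some i) + θ i then π else 0) + β i - α (some i) := by
      intro i
      simp only [hβdef, wrapAngle]
      split_ifs <;> ring
    rw [Finset.sum_congr rfl fun i _ => h1 i, Finset.sum_sub_distrib, Finset.sum_add_distrib,
      ← Finset.sum_filter, Finset.sum_const, nsmul_eq_mul]
  have hfib : ∑ i, β i = ∑ w : Option I, ∑ i with par i = w, β i :=
    (Finset.sum_fiberwise _ _ _).symm
  have hloss : ∑ w : Option I, (∑ i with par i = w, β i - α w)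
      ≤ (((Finset.univ.filter fun i : I => ∀ c, par c ≠ some i).card : ℝ) - 1) * (π / 2) := by
    rw [← card_children_sum par hroot, Finset.sum_mul, Finset.sum_filter]
    refine Finset.sum_le_sum fun w _ => ?_
    split_ifs with hw
    · have := sum_le_mergeAngle hβ hw
      rw [← hα w] at this
      linarith
    · push Not at hw
      have h0 : (Finset.univ.filter fun i => par i = w) = ∅ :=
        Finset.filter_eq_empty_iff.2 fun i _ => hw i
      rw [hα w, mergeAngle, if_neg (by rintro ⟨i, hi, _⟩; exact hw i hi), h0]
      simp
  rw [Finset.sum_sub_distrib, ← hfib, Fintype.sum_option] at hloss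
  have hcount : (j : ℝ) * π ≤ cross.card * π + α none := by linarith
  -- One condition per edge that is not crossing, and vanishing at the root when its angle is
  -- negative, since the final term -tan (α none) x² would then be nonnegative.
  let C : Finset (Option I) :=
    (Finset.univ.filter fun i => ¬ π / 2 ≤ α (some i) + θ i).map Function.Embedding.some
      ∪ (if α none < 0 then {none} else ∅)
  have hC : j + C.card ≤ Fintype.card I := by
    have h1 : C.card ≤ (Finset.univ.filter fun i => ¬ π / 2 ≤ α (some i) + θ i).card
        + (if α none < 0 then {none} else (∅ : Finset (Option I))).card := by
      refine (Finset.card_union_le _ _).trans ?_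
      rw [Finset.card_map]
    have h2 : cross.card + (Finset.univ.filter fun i => ¬ π / 2 ≤ α (some i) + θ i).card
        = Fintype.card I :=
      Finset.card_filter_add_card_filter_not (s := Finset.univ) _
    split_ifs at h1 with h0
    -- A negative root angle forces one crossing more than otherwise needed, which pays for the
    -- condition at the root. In the other case α none < π/2 and integrality give at least j
    -- crossings.
    · have : (j : ℝ) < cross.card := by
        by_contra! hcon
        nlinarith [pi_pos]
      have : j < cross.card := by exact_mod_cast this
      simp only [Finset.card_singleton] at h1
      omega
    · have : (j : ℝ) < cross.card + 1 := by
        have := (hαm none).2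
        by_contra! hcon
        nlinarith [pi_pos]
      have : j < cross.card + 1 := by exact_mod_cast this
      simp only [Finset.card_empty] at h1
      omega
  let L : Option I → (EuclideanSpace ℝ (Option I) →ₗ[ℝ] ℝ) := fun w => w.elim
    (EuclideanSpace.proj none : _ →L[ℝ] ℝ).toLinearMap
    fun i => cos (α (some i) + θ i) • (EuclideanSpace.proj (some i) : _ →L[ℝ] ℝ).toLinearMap
      - cos (α (some i)) • (EuclideanSpace.proj (par i) : _ →L[ℝ] ℝ).toLinearMap
  let φ : EuclideanSpace ℝ (Option I) →ₗ[ℝ] (C → ℝ) := LinearMap.pi fun w => L w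
  refine ⟨LinearMap.ker φ, ?_, fun x hx => ?_⟩
  · have h1 := LinearMap.finrank_range_add_finrank_ker φ
    have h2 := Submodule.finrank_le (LinearMap.range φ)
    rw [Module.finrank_fintype_fun_eq_card, Fintype.card_coe] at h2
    rw [finrank_euclideanSpace, Fintype.card_option] at h1
    omega
  · have hL : ∀ w ∈ C, L w x = 0 := fun w hw => congrFun (LinearMap.mem_ker.1 hx) ⟨w, hw⟩
    have hx1 : ∀ i, α (some i) + θ i < π / 2 →
        x (some i) * cos (α (some i) + θ i) = cos (α (some i)) * x (par i) := by
      intro i hi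
      have := hL (some i) (Finset.mem_union_left _ (by simpa using hi))
      simp only [L, Option.elim_some, LinearMap.sub_apply, LinearMap.smul_apply, smul_eq_mul,
        ContinuousLinearMap.coe_coe, PiLp.proj_apply] at this
      linarith
    have hx2 : α none < 0 → x none = 0 := by
      intro h
      have := hL none (Finset.mem_union_right _ (by simp [h]))
      simpa [L] using this
    have hx3 : ∀ w, α w = -(π / 2) → x w = 0 := by
      intro w hw
      rcases w with _ | i
      · exact hx2 (by linarith [pi_pos])
      · have := hx1 i (by linarith [(hθ i).2])
        rw [hw, cos_neg, cos_pi_div_two, zero_mul, add_comm, ← sub_eq_add_neg,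
          cos_sub_pi_div_two] at this
        exact (mul_eq_zero.1 this).resolve_right
          (sin_pos_of_pos_of_lt_pi (hθ i).1 (hθ i).2).ne'
    have hx4 : ∀ i, β i = -(π / 2) → x (par i) = 0 := by
      intro i hi
      refine hx3 _ ?_
      rw [hα, mergeAngle, if_pos ⟨i, rfl, hi⟩]
    -- Tangents add at a node, except at angle -π/2, where x vanishes. Hence the edge bounds
    -- telescope to the root term.
    have hx5 : ∀ w, (∑ i with par i = w, tan (β i)) * x w ^ 2 = tan (α w) * x w ^ 2 := by
      intro w
      by_cases h : ∃ i, par i = w ∧ β i = -(π / 2)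
      · obtain ⟨i, rfl, hi⟩ := h
        rw [hx4 i hi]
        ring
      · rw [hα w, mergeAngle, if_neg h, tan_arctan]
    calc _ ≤ ∑ i, (tan (α (some i)) * x (some i) ^ 2 - tan (β i) * x (par i) ^ 2) :=
          Finset.sum_le_sum fun i _ => edge_form_le (hαm _).1 (hαm _).2 (hθ i).1 (hθ i).2
            (hx1 i) (hx4 i)
      _ = ∑ i, tan (α (some i)) * x (some i) ^ 2 - ∑ w, tan (α w) * x w ^ 2 := by
          rw [Finset.sum_sub_distrib]
          congr 1
          rw [← Finset.sum_fiberwise Finset.univ par]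
          refine Finset.sum_congr rfl fun w _ => ?_
          rw [← hx5 w, Finset.sum_mul]
          refine Finset.sum_congr rfl fun i hi => ?_
          rw [(Finset.mem_filter.1 hi).2]
      _ = -(tan (α none) * x none ^ 2) := by
          rw [Fintype.sum_option]
          ring
      _ ≤ 0 := by
          rcases lt_or_ge (α none) 0 with h | h
          · rw [hx2 h]
            simp
          · have := tan_nonneg_of_nonneg_of_le_pi_div_two h (hαm none).2.le
            have := mul_nonneg this (sq_nonneg (x none))
            linarith

end Inertia

end QuantumGraph

/-! ### Functions on the metric graph: weak formulation, orthogonality and Rayleigh quotients. -/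

namespace QuantumGraph

open Set intervalIntegral MeasureTheory

section EdgeFunctions

variable {V : Type*} {G : SimpleGraph V} {ℓ : EdgeMetric G}

@[simp]
theorem EdgeMetric.dartLength_symm (ℓ : EdgeMetric G) (d : G.Dart) :
    ℓ.dartLength d.symm = ℓ.dartLength d := by
  simp [EdgeMetric.dartLength]

theorem MetricGraph.mk_eq_mk {p q : PrePoint ℓ} (h : Glue ℓ p q) :
    (MetricGraph.mk p : MetricGraph ℓ) = MetricGraph.mk q :=
  Quot.sound h

theorem MetricGraph.exists_mk (p : MetricGraph ℓ) : ∃ q : PrePoint ℓ, MetricGraph.mk q = p :=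
  Quot.exists_rep p

theorem onEdge_apply (f : MetricGraph ℓ → ℝ) (d : G.Dart) {x : ℝ}
    (hx : x ∈ Icc 0 (ℓ.dartLength d)) : onEdge f d x = f (MetricGraph.mk ⟨d, ⟨x, hx⟩⟩) := by
  rw [onEdge, projIcc_of_mem _ hx]

theorem onEdge_symm (f : MetricGraph ℓ → ℝ) (d : G.Dart) {x : ℝ}
    (hx : x ∈ Icc 0 (ℓ.dartLength d)) :
    onEdge f d.symm (ℓ.dartLength d - x) = onEdge f d x := by
  have hx' : ℓ.dartLength d - x ∈ Icc 0 (ℓ.dartLength d.symm) := by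
    rw [ℓ.dartLength_symm]
    constructor <;> linarith [hx.1, hx.2]
  rw [onEdge_apply f d hx, onEdge_apply f _ hx']
  exact congrArg f (MetricGraph.mk_eq_mk (Or.inl ⟨rfl, rfl⟩)).symm

theorem onEdge_zero_eq (f : MetricGraph ℓ → ℝ) {d e : G.Dart} (h : d.fst = e.fst) :
    onEdge f d 0 = onEdge f e 0 := by
  rw [onEdge_apply f d ⟨le_rfl, (ℓ.dartLength_pos d).le⟩,
    onEdge_apply f e ⟨le_rfl, (ℓ.dartLength_pos e).le⟩]
  exact congrArg f (MetricGraph.mk_eq_mk (Or.inr ⟨h, rfl, rfl⟩))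

theorem exists_vertex_value (f : MetricGraph ℓ → ℝ) :
    ∃ c : V → ℝ, ∀ d : G.Dart, onEdge f d 0 = c d.fst := by
  classical
  refine ⟨fun v => if h : ∃ d : G.Dart, d.fst = v then onEdge f h.choose 0 else 0, fun d => ?_⟩
  have h : ∃ e : G.Dart, e.fst = d.fst := ⟨d, rfl⟩
  simp only [dif_pos h]
  exact onEdge_zero_eq f h.choose_spec.symm

theorem continuous_onEdge {f : MetricGraph ℓ → ℝ} (hf : Continuous f) (d : G.Dart) :
    Continuous (onEdge f d) := by
  have h1 : Continuous (MetricGraph.mk (ℓ := ℓ)) := continuous_quot_mk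
  have h2 : Continuous fun x : Icc (0 : ℝ) (ℓ.dartLength d) => (⟨d, x⟩ : PrePoint ℓ) :=
    continuous_sigmaMk (σ := fun d : G.Dart => Icc (0 : ℝ) (ℓ.dartLength d)) (i := d)
  exact hf.comp (h1.comp (h2.comp continuous_projIcc))

theorem eq_zero_of_onEdge_eq_zero {f : MetricGraph ℓ → ℝ}
    (h : ∀ d : G.Dart, ∀ x ∈ Icc 0 (ℓ.dartLength d), onEdge f d x = 0) : f = 0 := by
  funext p
  obtain ⟨⟨d, x, hx⟩, rfl⟩ := p.exists_mk
  rw [← onEdge_apply f d hx]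
  exact h d x hx

/-- `f` is a continuous function on the metric graph with continuous derivative `f'` along the
oriented edges. -/
structure HasEdgeDeriv (f : MetricGraph ℓ → ℝ) (f' : G.Dart → ℝ → ℝ) : Prop where
  continuous : Continuous f
  hasDeriv : ∀ d : G.Dart, ∀ x ∈ Icc 0 (ℓ.dartLength d),
    HasDerivWithinAt (onEdge f d) (f' d x) (Icc 0 (ℓ.dartLength d)) x
  continuousOn : ∀ d : G.Dart, ContinuousOn (f' d) (Icc 0 (ℓ.dartLength d))

theorem HasEdgeDeriv.symm_apply {f : MetricGraph ℓ → ℝ} {f' : G.Dart → ℝ → ℝ}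
    (hf : HasEdgeDeriv f f') (d : G.Dart) {x : ℝ} (hx : x ∈ Icc 0 (ℓ.dartLength d)) :
    f' d x = -f' d.symm (ℓ.dartLength d - x) := by
  have hx' : ℓ.dartLength d - x ∈ Icc 0 (ℓ.dartLength d) := by
    constructor <;> linarith [hx.1, hx.2]
  have h1 := hf.hasDeriv d x hx
  have h2 := hf.hasDeriv d.symm (ℓ.dartLength d - x) (by rwa [ℓ.dartLength_symm])
  rw [ℓ.dartLength_symm] at h2
  have h3 : HasDerivWithinAt (fun x => ℓ.dartLength d - x) (-1) (Icc 0 (ℓ.dartLength d)) x := by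
    simpa using (hasDerivWithinAt_id x (Icc 0 (ℓ.dartLength d))).const_sub (ℓ.dartLength d)
  have h4 : HasDerivWithinAt (onEdge f d.symm ∘ fun x => ℓ.dartLength d - x)
      (f' d.symm (ℓ.dartLength d - x) * -1) (Icc 0 (ℓ.dartLength d)) x := by
    refine HasDerivWithinAt.comp _ (s' := Icc 0 (ℓ.dartLength d)) h2 h3 ?_
    intro y hy
    constructor <;> simp only <;> linarith [hy.1, hy.2]
  have h5 := h4.congr (fun y hy => (onEdge_symm f d hy).symm) (onEdge_symm f d hx).symm
  rw [(uniqueDiffOn_Icc (ℓ.dartLength_pos d) _ hx).eq_deriv _ h1 h5]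
  ring

theorem HasEdgeDeriv.symm_end {f : MetricGraph ℓ → ℝ} {f' : G.Dart → ℝ → ℝ}
    (hf : HasEdgeDeriv f f') (d : G.Dart) : f' d (ℓ.dartLength d) = -f' d.symm 0 := by
  rw [hf.symm_apply d ⟨(ℓ.dartLength_pos d).le, le_rfl⟩, sub_self]

theorem HasEdgeDeriv.integral_symm {f : MetricGraph ℓ → ℝ} {f' : G.Dart → ℝ → ℝ}
    (hf : HasEdgeDeriv f f') (d : G.Dart) :
    ∫ x in (0 : ℝ)..ℓ.dartLength d, f' d x * f' d x
      = ∫ x in (0 : ℝ)..ℓ.dartLength d.symm, f' d.symm x * f' d.symm x := by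
  have h := intervalIntegral.integral_comp_sub_left (a := 0) (b := ℓ.dartLength d)
    (fun x => f' d.symm x * f' d.symm x) (ℓ.dartLength d)
  rw [sub_self, sub_zero] at h
  rw [ℓ.dartLength_symm, ← h]
  refine integral_congr fun x hx => ?_
  rw [uIcc_of_le (ℓ.dartLength_pos d).le] at hx
  simp only [hf.symm_apply d hx, neg_mul_neg]

theorem integral_onEdge_symm (f : MetricGraph ℓ → ℝ) (d : G.Dart) :
    ∫ x in (0 : ℝ)..ℓ.dartLength d, onEdge f d x * onEdge f d x
      = ∫ x in (0 : ℝ)..ℓ.dartLength d.symm, onEdge f d.symm x * onEdge f d.symm x := by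
  have h := intervalIntegral.integral_comp_sub_left (a := 0) (b := ℓ.dartLength d)
    (fun x => onEdge f d.symm x * onEdge f d.symm x) (ℓ.dartLength d)
  rw [sub_self, sub_zero] at h
  rw [ℓ.dartLength_symm, ← h]
  refine integral_congr fun x hx => ?_
  rw [uIcc_of_le (ℓ.dartLength_pos d).le] at hx
  simp only [onEdge_symm f d hx]

end EdgeFunctions

section Forms

variable {V : Type*} {G : SimpleGraph V} [Fintype V] [DecidableRel G.Adj] {ℓ : EdgeMetric G}

/-- Twice the `L²` inner product (every edge is counted in both orientations). -/
noncomputable def edgeInner (f g : MetricGraph ℓ → ℝ) : ℝ :=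
  ∑ d : G.Dart, ∫ x in (0 : ℝ)..ℓ.dartLength d, onEdge f d x * onEdge g d x

theorem edgeInner_comm (f g : MetricGraph ℓ → ℝ) : edgeInner f g = edgeInner g f := by
  simp only [edgeInner, mul_comm]

theorem edgeInner_sum {ι : Type*} (s : Finset ι) {f : MetricGraph ℓ → ℝ}
    {g : ι → MetricGraph ℓ → ℝ} (hf : Continuous f) (hg : ∀ i ∈ s, Continuous (g i)) :
    edgeInner f (∑ i ∈ s, g i) = ∑ i ∈ s, edgeInner f (g i) := by
  unfold edgeInner
  rw [Finset.sum_comm]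
  refine Finset.sum_congr rfl fun d _ => ?_
  rw [← intervalIntegral.integral_finsetSum (f := fun i x => onEdge f d x * onEdge (g i) d x)
    fun i hi =>
      ((continuous_onEdge hf d).mul (continuous_onEdge (hg i hi) d)).intervalIntegrable _ _]
  refine integral_congr fun x _ => ?_
  simp [onEdge, Finset.mul_sum]

theorem edgeInner_self_pos {f : MetricGraph ℓ → ℝ} (hf : Continuous f) (h0 : f ≠ 0) :
    0 < edgeInner f f := by
  have hnn : ∀ d : G.Dart, 0 ≤ ∫ x in (0 : ℝ)..ℓ.dartLength d, onEdge f d x * onEdge f d x :=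
    fun d => integral_nonneg (ℓ.dartLength_pos d).le fun x _ => mul_self_nonneg _
  by_contra! hcon
  refine h0 (eq_zero_of_onEdge_eq_zero fun d x hx => ?_)
  by_contra hne
  refine absurd hcon (not_le.2 (Finset.sum_pos' (fun d _ => hnn d) ⟨d, Finset.mem_univ _, ?_⟩))
  exact integral_pos (ℓ.dartLength_pos d)
    ((continuous_onEdge hf d).mul (continuous_onEdge hf d)).continuousOn
    (fun x _ => mul_self_nonneg _) ⟨x, hx, mul_self_pos.2 hne⟩

variable [DecidableEq V]

/-- Integration by parts. The boundary term at the end of an edge is the initial term of the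
reversed edge, so boundary terms regroup by vertices, where g is single-valued and the derivatives
of f sum to zero. -/
theorem SolvesNeumann.exists_hasEdgeDeriv {lam : ℝ} {f : MetricGraph ℓ → ℝ}
    (hf : SolvesNeumann lam f) : ∃ f', HasEdgeDeriv f f' ∧
      ∀ g g', HasEdgeDeriv g g' → ∑ d : G.Dart, ∫ x in (0 : ℝ)..ℓ.dartLength d, f' d x * g' d x
        = lam * edgeInner f g := by
  obtain ⟨hc, f', hd, hv⟩ := hf
  have hf' : HasEdgeDeriv f f' := ⟨hc, fun d x hx => (hd d x hx).1,
    fun d x hx => (hd d x hx).2.continuousWithinAt⟩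
  refine ⟨f', hf', fun g g' hg => ?_⟩
  have hparts : ∀ d : G.Dart, ∫ x in (0 : ℝ)..ℓ.dartLength d, f' d x * g' d x
      = lam * (∫ x in (0 : ℝ)..ℓ.dartLength d, onEdge f d x * onEdge g d x)
        - f' d.symm 0 * onEdge g d.symm 0 - f' d 0 * onEdge g d 0 := by
    intro d
    have hl := (ℓ.dartLength_pos d).le
    have hu := uIcc_of_le hl
    rw [integral_mul_deriv_eq_deriv_mul_of_hasDerivWithinAt (u := f' d) (v := onEdge g d)
      (u' := fun x => -(lam * onEdge f d x))
      (by rw [hu]; exact fun x hx => (hd d x hx).2) (by rw [hu]; exact hg.hasDeriv d)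
      (((continuous_onEdge hc d).const_mul lam).neg.intervalIntegrable _ _)
      ((hg.continuousOn d).intervalIntegrable_of_Icc hl), ← intervalIntegral.integral_const_mul,
      hf'.symm_end d]
    have h1 := onEdge_symm g d (x := ℓ.dartLength d) ⟨hl, le_rfl⟩
    rw [sub_self] at h1
    rw [← h1]
    have h2 : ∫ x in (0 : ℝ)..ℓ.dartLength d, -(lam * onEdge f d x) * onEdge g d x
        = -∫ x in (0 : ℝ)..ℓ.dartLength d, lam * (onEdge f d x * onEdge g d x) := by
      rw [← intervalIntegral.integral_neg]
      exact integral_congr fun x _ => by ring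
    rw [h2]
    linarith
  have hvert : ∑ d : G.Dart, f' d 0 * onEdge g d 0 = 0 := by
    obtain ⟨c, hcv⟩ := exists_vertex_value g
    rw [← Finset.sum_fiberwise Finset.univ fun d : G.Dart => d.fst]
    refine Finset.sum_eq_zero fun v _ => ?_
    refine Eq.trans ?_ ((congrArg (c v * ·) (hv v)).trans (mul_zero (c v)))
    refine Eq.trans (Finset.sum_congr rfl fun d hd => ?_) (Finset.mul_sum _ _ _).symm
    rw [show onEdge g d 0 = c v by rw [hcv d, (Finset.mem_filter.1 hd).2], mul_comm]
  have hvert' : ∑ d : G.Dart, f' d.symm 0 * onEdge g d.symm 0 = 0 := by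
    refine Eq.trans ?_ hvert
    exact Function.Bijective.sum_comp SimpleGraph.Dart.symm_involutive.bijective
      fun d : G.Dart => f' d 0 * onEdge g d 0
  rw [Finset.sum_congr rfl fun d _ => hparts d, Finset.sum_sub_distrib, Finset.sum_sub_distrib,
    hvert, hvert', ← Finset.mul_sum, edgeInner]
  ring

theorem SolvesNeumann.edgeInner_eq_zero {lam mu : ℝ} {f g : MetricGraph ℓ → ℝ}
    (hf : SolvesNeumann lam f) (hg : SolvesNeumann mu g) (h : lam ≠ mu) : edgeInner f g = 0 := by
  obtain ⟨f', hf', hfE⟩ := hf.exists_hasEdgeDeriv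
  obtain ⟨g', hg', hgE⟩ := hg.exists_hasEdgeDeriv
  have h1 := hfE g g' hg'
  have h2 := hgE f f' hf'
  rw [edgeInner_comm g f, Finset.sum_congr rfl fun d _ => integral_congr fun x _ =>
    mul_comm (g' d x) (f' d x), h1] at h2
  have h3 : (lam - mu) * edgeInner f g = 0 := by linarith
  exact (mul_eq_zero.1 h3).resolve_left (sub_ne_zero.2 h)

/-- Combinations of eigenfunctions with eigenvalues below `s` have Rayleigh quotient below `s`. -/
theorem exists_energy_lt {s : ℝ} {f : MetricGraph ℓ → ℝ} (hf : f ∈ eigenspan ℓ (Iio s))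
    (h0 : f ≠ 0) : ∃ f', HasEdgeDeriv f f' ∧
      ∑ d : G.Dart, ∫ x in (0 : ℝ)..ℓ.dartLength d, f' d x * f' d x < s * edgeInner f f := by
  classical
  rw [eigenspan, iSup_subtype', Submodule.mem_iSup_iff_exists_finsupp] at hf
  obtain ⟨F, hF, rfl⟩ := hf
  have hS : ∀ i : Iio s, SolvesNeumann (i : ℝ) (F i) := fun i => hF i
  choose F' hF' hE using fun i => (hS i).exists_hasEdgeDeriv
  have hc : ∀ i, Continuous (F i) := fun i => (hF' i).continuous
  have hsum : (F.sum fun _ xi => xi) = ∑ i ∈ F.support, F i := rfl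
  rw [hsum] at h0 ⊢
  have hd : HasEdgeDeriv (∑ i ∈ F.support, F i) fun d x => ∑ i ∈ F.support, F' i d x := by
    refine ⟨?_, fun d x hx => ?_, fun d => continuousOn_finsetSum _ fun i _ =>
      (hF' i).continuousOn d⟩
    · have := continuous_finsetSum F.support fun i _ => hc i
      convert this using 1
      funext x
      simp
    · have := HasDerivWithinAt.fun_sum (u := F.support) fun i _ => (hF' i).hasDeriv d x hx
      refine this.congr (fun y _ => ?_) ?_ <;> simp [onEdge]
  refine ⟨_, hd, ?_⟩
  have hip : ∀ i ∈ F.support, edgeInner (F i) (∑ k ∈ F.support, F k) = edgeInner (F i) (F i) := by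
    intro i hi
    rw [edgeInner_sum _ (hc i) fun k _ => hc k]
    refine Finset.sum_eq_single_of_mem i hi fun k _ hk => ?_
    exact (hS i).edgeInner_eq_zero (hS k) fun h => hk (Subtype.ext h.symm)
  have hnorm : edgeInner (∑ i ∈ F.support, F i) (∑ i ∈ F.support, F i)
      = ∑ i ∈ F.support, edgeInner (F i) (F i) := by
    rw [edgeInner_sum _ hd.continuous fun k _ => hc k]
    refine Finset.sum_congr rfl fun i hi => ?_
    rw [edgeInner_comm, hip i hi]
  have hen : ∑ d : G.Dart, ∫ x in (0 : ℝ)..ℓ.dartLength d,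
      (∑ i ∈ F.support, F' i d x) * (∑ i ∈ F.support, F' i d x)
      = ∑ i ∈ F.support, (i : ℝ) * edgeInner (F i) (F i) := by
    rw [← Finset.sum_congr rfl fun i hi =>
      congrArg (fun r : ℝ => ((i : Iio s) : ℝ) * r) (hip i hi)]
    rw [← Finset.sum_congr rfl fun i _ => hE i _ _ hd, Finset.sum_comm]
    refine Finset.sum_congr rfl fun d _ => ?_
    rw [← intervalIntegral.integral_finsetSum fun i _ => ?_]
    · exact integral_congr fun x _ => by simp only [Finset.sum_mul]
    · exact (((hF' i).continuousOn d).mul (hd.continuousOn d)).intervalIntegrable_of_Icc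
        (ℓ.dartLength_pos d).le
  rw [hen, hnorm, Finset.mul_sum]
  have hne : F.support.Nonempty := by
    rw [Finset.nonempty_iff_ne_empty]
    intro h
    rw [h] at h0
    simp at h0
  refine Finset.sum_lt_sum_of_nonempty hne fun i hi => ?_
  exact mul_lt_mul_of_pos_right i.2 (edgeInner_self_pos (hc i) (Finsupp.mem_support_iff.1 hi))

/-- If functions in the span of the eigenfunctions below `s` are determined by their values at
finitely many points, then there are at most as many eigenvalues below `s`. -/
theorem rank_eigenspan_le {s : ℝ} {ι : Type*} [Fintype ι] (pt : ι → MetricGraph ℓ)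
    (h : ∀ f f', HasEdgeDeriv f f' → (∀ i, f (pt i) = 0) →
      s * edgeInner f f ≤ ∑ d : G.Dart, ∫ x in (0 : ℝ)..ℓ.dartLength d, f' d x * f' d x) :
    Module.rank ℝ (eigenspan ℓ (Iio s)) ≤ (Fintype.card ι : Cardinal) := by
  let φ : eigenspan ℓ (Iio s) →ₗ[ℝ] (ι → ℝ) :=
    LinearMap.pi fun i => (LinearMap.proj (pt i)) ∘ₗ (eigenspan ℓ (Iio s)).subtype
  have hφ : Function.Injective φ := by
    rw [← LinearMap.ker_eq_bot, LinearMap.ker_eq_bot']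
    intro f hf
    by_contra h0
    obtain ⟨f', hf', hlt⟩ := exists_energy_lt f.2 (by simpa using h0)
    exact absurd (h f f' hf' fun i => congrFun hf i) (not_le.2 hlt)
  have h1 := LinearMap.lift_rank_le_of_injective φ hφ
  rw [rank_fun'] at h1
  simpa using h1

end Forms

/-! ### Energy estimates on an interval by a Riccati equation. -/

section Riccati

open Real

variable {u u' : ℝ → ℝ} {a b σ η : ℝ}

/-- With y = σ cot(σ(x - a) + η) one has y' = -σ² - y², so (u² y)' = u'² - σ² u² - (u' - u y)². The
phase stays in (0, π), where y is smooth; integrate. -/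
theorem riccati_le_integral (hab : a ≤ b)
    (hu : ∀ x ∈ Icc a b, HasDerivWithinAt u (u' x) (Icc a b) x) (hu' : ContinuousOn u' (Icc a b))
    (hη : 0 < η) (hσ : 0 ≤ σ) (hπ : σ * (b - a) + η < π) :
    σ ^ 2 * (∫ x in a..b, u x * u x) + (σ * cot (σ * (b - a) + η) * u b ^ 2 - σ * cot η * u a ^ 2)
      ≤ ∫ x in a..b, u' x * u' x := by
  have huc : ContinuousOn u (Icc a b) := fun x hx => (hu x hx).continuousWithinAt
  have hsin : ∀ x ∈ Icc a b, 0 < sin (σ * (x - a) + η) := by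
    intro x hx
    have h1 : 0 ≤ σ * (x - a) := mul_nonneg hσ (by linarith [hx.1])
    have h2 : σ * (x - a) ≤ σ * (b - a) := mul_le_mul_of_nonneg_left (by linarith [hx.2]) hσ
    exact sin_pos_of_pos_of_lt_pi (by linarith) (by linarith)
  let y : ℝ → ℝ := fun x => σ * (cos (σ * (x - a) + η) / sin (σ * (x - a) + η))
  let y' : ℝ → ℝ := fun x => -σ ^ 2 - y x ^ 2
  have hy : ∀ x ∈ Icc a b, HasDerivAt y (y' x) x := by
    intro x hx
    have h1 : HasDerivAt (fun x => σ * (x - a) + η) σ x := by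
      simpa using (((hasDerivAt_id x).sub_const a).const_mul σ).add_const η
    have h2 := ((h1.cos.div h1.sin (hsin x hx).ne').const_mul σ)
    refine h2.congr_deriv ?_
    simp only [y', y]
    have := (hsin x hx).ne'
    field_simp
  have hyc : ContinuousOn y (Icc a b) := fun x hx => (hy x hx).continuousAt.continuousWithinAt
  have hyc' : ContinuousOn y' (Icc a b) := continuousOn_const.sub (hyc.pow 2)
  have hFTC : ∫ x in a..b, (2 * u x * u' x * y x + u x ^ 2 * y' x)
      = u b ^ 2 * y b - u a ^ 2 * y a := by
    refine integral_eq_sub_of_hasDerivAt_of_le (f := fun x => u x ^ 2 * y x) hab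
      ((huc.pow 2).mul hyc) (fun x hx => ?_) ?_
    · have h1 := (hu x (Ioo_subset_Icc_self hx)).hasDerivAt (Icc_mem_nhds hx.1 hx.2)
      refine ((h1.pow 2).mul (hy x (Ioo_subset_Icc_self hx))).congr_deriv ?_
      simp
    · refine ContinuousOn.intervalIntegrable_of_Icc hab ?_
      exact (((continuousOn_const.mul huc).mul hu').mul hyc).add ((huc.pow 2).mul hyc')
  have hmono : ∫ x in a..b, (2 * u x * u' x * y x + u x ^ 2 * y' x)
      ≤ ∫ x in a..b, (u' x * u' x - σ ^ 2 * (u x * u x)) := by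
    refine integral_mono_on hab ?_ ?_ fun x _ => ?_
    · refine ContinuousOn.intervalIntegrable_of_Icc hab ?_
      exact (((continuousOn_const.mul huc).mul hu').mul hyc).add ((huc.pow 2).mul hyc')
    · refine ContinuousOn.intervalIntegrable_of_Icc hab ?_
      exact (hu'.mul hu').sub (continuousOn_const.mul (huc.mul huc))
    · simp only [y']
      nlinarith [sq_nonneg (u' x - u x * y x)]
  rw [intervalIntegral.integral_sub (f := fun x => u' x * u' x)
    (g := fun x => σ ^ 2 * (u x * u x)) ((hu'.mul hu').intervalIntegrable_of_Icc hab)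
    ((continuousOn_const.mul (huc.mul huc)).intervalIntegrable_of_Icc hab),
    intervalIntegral.integral_const_mul, hFTC] at hmono
  have e1 : y b = σ * cot (σ * (b - a) + η) := by simp only [y, cot_eq_cos_div_sin]
  have e2 : y a = σ * cot η := by simp only [y, cot_eq_cos_div_sin, sub_self, mul_zero, zero_add]
  rw [e1, e2] at hmono
  linarith

theorem dirichlet_mesh_le_integral {t : ℕ → ℝ} {m : ℕ} (ht : ∀ i < m, t i ≤ t (i + 1))
    (hu : ∀ x ∈ Icc (t 0) (t m), HasDerivWithinAt u (u' x) (Icc (t 0) (t m)) x)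
    (hu' : ContinuousOn u' (Icc (t 0) (t m))) (hσ : 0 ≤ σ)
    (hπ : ∀ i < m, σ * (t (i + 1) - t i) < π) (h0 : ∀ i ≤ m, u (t i) = 0) :
    σ ^ 2 * (∫ x in (t 0)..(t m), u x * u x) ≤ ∫ x in (t 0)..(t m), u' x * u' x := by
  have hmono : ∀ i j, i ≤ j → j ≤ m → t i ≤ t j := by
    intro i j hij hjm
    induction j, hij using Nat.le_induction with
    | base => exact le_rfl
    | succ j _ ih => exact (ih (by omega)).trans (ht j (by omega))
  have hsub : ∀ i < m, Icc (t i) (t (i + 1)) ⊆ Icc (t 0) (t m) := fun i hi =>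
    Icc_subset_Icc (hmono 0 i (by omega) (by omega)) (hmono (i + 1) m (by omega) le_rfl)
  have huc : ContinuousOn u (Icc (t 0) (t m)) := fun x hx => (hu x hx).continuousWithinAt
  rw [← sum_integral_adjacent_intervals (f := fun x => u x * u x) fun i hi =>
      ((huc.mul huc).mono (hsub i hi)).intervalIntegrable_of_Icc (ht i hi),
    ← sum_integral_adjacent_intervals (f := fun x => u' x * u' x) fun i hi =>
      ((hu'.mul hu').mono (hsub i hi)).intervalIntegrable_of_Icc (ht i hi), Finset.mul_sum]
  refine Finset.sum_le_sum fun i hi => ?_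
  have hi' := Finset.mem_range.1 hi
  -- This phase centres the piece inside (0, π). Its boundary terms vanish since u is zero at both
  -- ends.
  have := riccati_le_integral (η := (π - σ * (t (i + 1) - t i)) / 2) (ht i hi')
    (fun x hx => (hu x (hsub i hi' hx)).mono (hsub i hi')) (hu'.mono (hsub i hi'))
    (by linarith [hπ i hi']) hσ (by linarith [hπ i hi'])
  rw [h0 i (by omega), h0 (i + 1) (by omega)] at this
  simpa using this

end Riccati

section Finite

variable {V : Type*} {G : SimpleGraph V} [Fintype V] [DecidableEq V] [DecidableRel G.Adj]
  (ℓ : EdgeMetric G)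

/-- Vanishing on a mesh with steps below π/√s forces energy at least s times the mass, so evaluation
on that finite mesh is injective on the span. -/
theorem rank_eigenspan_Iio_lt_aleph0 (s : ℝ) :
    Module.rank ℝ (eigenspan ℓ (Iio s)) < Cardinal.aleph0 := by
  wlog hs : 0 < s generalizing s
  · refine lt_of_le_of_lt (Submodule.rank_mono ?_) (this 1 one_pos)
    exact biSup_mono fun x hx => lt_of_lt_of_le (lt_of_lt_of_le hx (not_lt.1 hs)) zero_le_one
  obtain ⟨n, hn⟩ := exists_nat_gt (∑ d : G.Dart, √s * ℓ.dartLength d)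
  have hn0 : (0 : ℝ) < n := lt_of_le_of_lt (Finset.sum_nonneg fun d _ =>
    mul_nonneg (Real.sqrt_nonneg s) (ℓ.dartLength_pos d).le) hn
  have hmem : ∀ (d : G.Dart) (i : ℕ), i ≤ n →
      (i : ℝ) * (ℓ.dartLength d / n) ∈ Icc 0 (ℓ.dartLength d) := by
    intro d i hi
    have hl := ℓ.dartLength_pos d
    refine ⟨by positivity, ?_⟩
    calc (i : ℝ) * (ℓ.dartLength d / n) ≤ n * (ℓ.dartLength d / n) := by gcongr
      _ = ℓ.dartLength d := by field_simp
  refine lt_of_le_of_lt (rank_eigenspan_le (ι := G.Dart × Fin (n + 1))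
    (fun p => MetricGraph.mk ⟨p.1, ⟨_, hmem p.1 p.2 (by omega)⟩⟩) fun f f' hf h0 => ?_)
    (Cardinal.natCast_lt_aleph0)
  rw [edgeInner, Finset.mul_sum]
  refine Finset.sum_le_sum fun d _ => ?_
  have hl := ℓ.dartLength_pos d
  have e0 : ((0 : ℕ) : ℝ) * (ℓ.dartLength d / n) = 0 := by simp
  have e1 : (n : ℝ) * (ℓ.dartLength d / n) = ℓ.dartLength d := by field_simp
  have := dirichlet_mesh_le_integral (u := onEdge f d) (u' := f' d) (σ := √s)
    (t := fun i : ℕ => (i : ℝ) * (ℓ.dartLength d / n)) (m := n)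
    (fun i _ => by push_cast; rw [add_mul, one_mul]; linarith [div_nonneg hl.le hn0.le])
    (by rw [e0, e1]; exact hf.hasDeriv d) (by rw [e0, e1]; exact hf.continuousOn d)
    (Real.sqrt_nonneg s)
    (fun i _ => by
      push_cast
      rw [add_mul, one_mul, add_sub_cancel_left, mul_div_assoc', div_lt_iff₀ hn0]
      have h1 : √s * ℓ.dartLength d ≤ ∑ d : G.Dart, √s * ℓ.dartLength d :=
        Finset.single_le_sum (f := fun d : G.Dart => √s * ℓ.dartLength d)
          (fun d _ => mul_nonneg (Real.sqrt_nonneg s) (ℓ.dartLength_pos d).le)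
          (Finset.mem_univ d)
      nlinarith [Real.pi_gt_three])
    (fun i hi => by
      rw [onEdge_apply f d (hmem d i hi)]
      exact h0 (d, ⟨i, by omega⟩))
  simp only [e0, e1, Real.sq_sqrt hs.le] at this
  exact this

end Finite

end QuantumGraph

/-! ### Rooted trees. -/

namespace QuantumGraph

/-- A tree with root `a`: every other vertex has a parent, which is closer to the root, and every
edge joins a vertex to its parent. -/
structure Rooting {V : Type*} (G : SimpleGraph V) (a : V) where
  par : V → V
  adj : ∀ v, v ≠ a → G.Adj v (par v)
  dist : ∀ v, v ≠ a → G.dist a v = G.dist a (par v) + 1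
  cover : ∀ u v, G.Adj u v → (u ≠ a ∧ par u = v) ∨ (v ≠ a ∧ par v = u)

/-- The parent is the next vertex on a shortest walk to the root. Two candidates would give two
paths from the root to the same vertex. -/
theorem exists_rooting {V : Type*} {G : SimpleGraph V} (hG : G.IsTree) (a : V) :
    Nonempty (Rooting G a) := by
  classical
  have hex : ∀ v, v ≠ a → ∃ u, G.Adj v u ∧ G.dist a v = G.dist a u + 1 := by
    intro v hv
    obtain ⟨p, hp⟩ := hG.connected.exists_walk_length_eq_dist v a
    have hn : ¬ p.Nil := SimpleGraph.Walk.not_nil_of_ne hv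
    have hadj := p.adj_snd hn
    refine ⟨p.snd, hadj, ?_⟩
    have h1 := SimpleGraph.Walk.length_tail_add_one hn
    have h2 : G.dist p.snd a ≤ p.tail.length := SimpleGraph.dist_le _
    rw [SimpleGraph.dist_comm, SimpleGraph.dist_comm (u := a)]
    have h3 := hG.dist_eq_dist_add_one_of_adj a hadj
    rw [SimpleGraph.dist_comm, SimpleGraph.dist_comm (u := a)] at h3
    omega
  have huniq : ∀ v u u', G.Adj v u → G.Adj v u' → G.dist a v = G.dist a u + 1 →
      G.dist a v = G.dist a u' + 1 → u = u' := by
    intro v u u' h h' hd hd'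
    obtain ⟨p, hp⟩ := hG.connected.exists_walk_length_eq_dist a u
    obtain ⟨p', hp'⟩ := hG.connected.exists_walk_length_eq_dist a u'
    have hq : (p.concat h.symm).IsPath := SimpleGraph.Walk.isPath_of_length_eq_dist _ (by
      rw [SimpleGraph.Walk.length_concat]; omega)
    have hq' : (p'.concat h'.symm).IsPath := SimpleGraph.Walk.isPath_of_length_eq_dist _ (by
      rw [SimpleGraph.Walk.length_concat]; omega)
    have := (hG.existsUnique_path a v).unique hq hq'
    have := congrArg SimpleGraph.Walk.penultimate this
    simpa using this
  choose! par hpar using hex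
  refine ⟨⟨par, fun v hv => (hpar v hv).1, fun v hv => (hpar v hv).2, fun u v huv => ?_⟩⟩
  rcases hG.dist_eq_dist_add_one_of_adj a huv with h | h
  · have hu : u ≠ a := by
      rintro rfl
      simp at h
    exact Or.inl ⟨hu, huniq u _ _ (hpar u hu).1 huv (hpar u hu).2 h⟩
  · have hv : v ≠ a := by
      rintro rfl
      simp at h
    exact Or.inr ⟨hv, huniq v _ _ (hpar v hv).1 huv.symm (hpar v hv).2 h⟩

namespace Rooting

variable {V : Type*} {G : SimpleGraph V} {a : V} (R : Rooting G a)

theorem par_par_ne {v : V} (hv : v ≠ a) (hv' : R.par v ≠ a) : R.par (R.par v) ≠ v := by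
  intro h
  have h1 := R.dist v hv
  have h2 := R.dist _ hv'
  rw [h] at h2
  omega

/-- The oriented edge from a vertex to its parent. -/
def up (v : {v : V // v ≠ a}) : G.Dart := ⟨(v, R.par v), R.adj v v.2⟩

@[simp] theorem up_fst (v : {v : V // v ≠ a}) : (R.up v).fst = v := rfl

@[simp] theorem up_snd (v : {v : V // v ≠ a}) : (R.up v).snd = R.par v := rfl

theorem up_injective : Function.Injective R.up := fun _ _ h =>
  Subtype.ext (congrArg (fun d : G.Dart => d.fst) h)

theorem up_ne_symm (v w : {v : V // v ≠ a}) : R.up v ≠ (R.up w).symm := by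
  intro h
  have h1 : (v : V) = R.par w := congrArg (fun d : G.Dart => d.fst) h
  have h2 : R.par v = w := congrArg (fun d : G.Dart => d.snd) h
  rw [h1] at h2
  exact R.par_par_ne w.2 (h1 ▸ v.2) h2

theorem exists_up (d : G.Dart) :
    (∃ v, d = R.up v) ∨ ∃ v, d = (R.up v).symm := by
  rcases R.cover d.fst d.snd d.adj with ⟨h, h'⟩ | ⟨h, h'⟩
  · exact Or.inl ⟨⟨d.fst, h⟩, SimpleGraph.Dart.ext _ _ (Prod.ext rfl h'.symm)⟩
  · exact Or.inr ⟨⟨d.snd, h⟩, SimpleGraph.Dart.ext _ _ (Prod.ext h'.symm rfl)⟩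

/-- The oriented edges are those going up and those going down. -/
noncomputable def dartEquiv : {v : V // v ≠ a} ⊕ {v : V // v ≠ a} ≃ G.Dart :=
  Equiv.ofBijective (Sum.elim R.up fun v => (R.up v).symm) <| by
    constructor
    · refine Function.Injective.sumElim R.up_injective ?_ R.up_ne_symm
      exact SimpleGraph.Dart.symm_involutive.injective.comp R.up_injective
    · intro d
      rcases R.exists_up d with ⟨v, rfl⟩ | ⟨v, rfl⟩
      · exact ⟨Sum.inl v, rfl⟩
      · exact ⟨Sum.inr v, rfl⟩

/-- Every edge joins a unique vertex to its parent. -/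
noncomputable def edgeEquiv : {v : V // v ≠ a} ≃ G.edgeSet :=
  Equiv.ofBijective (fun v => ⟨(R.up v).edge, (R.up v).edge_mem⟩) <| by
    constructor
    · intro v w h
      rcases SimpleGraph.dart_edge_eq_iff _ _ |>.1 (congrArg Subtype.val h) with h | h
      · exact R.up_injective h
      · exact absurd h (R.up_ne_symm v w)
    · rintro ⟨e, he⟩
      induction e with
      | h x y =>
        rcases R.cover x y he with ⟨h, h'⟩ | ⟨h, h'⟩
        · exact ⟨⟨x, h⟩, Subtype.ext (by simp [up, SimpleGraph.Dart.edge, h'])⟩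
        · exact ⟨⟨y, h⟩, Subtype.ext (by simp [up, SimpleGraph.Dart.edge, h', Sym2.eq_swap])⟩

variable [Fintype V] [DecidableEq V]

theorem totalLength_eq [Fintype G.edgeSet] (ℓ : EdgeMetric G) :
    ℓ.totalLength = ∑ v, ℓ.dartLength (R.up v) :=
  (R.edgeEquiv.sum_comp ℓ.length).symm

variable [DecidableRel G.Adj]

theorem sum_darts (g : G.Dart → ℝ) : ∑ d, g d = ∑ v, g (R.up v) + ∑ v, g (R.up v).symm := by
  rw [← R.dartEquiv.sum_comp g, Fintype.sum_sum_type]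
  rfl

theorem sum_darts_from (g : G.Dart → ℝ) (w : V) :
    ∑ d with d.fst = w, g d = (if h : w ≠ a then g (R.up ⟨w, h⟩) else 0)
      + ∑ v with R.par v.1 = w, g (R.up v).symm := by
  rw [Finset.sum_filter, R.sum_darts, Finset.sum_filter]
  congr 1
  split_ifs with h
  · rw [Finset.sum_eq_single_of_mem (⟨w, h⟩ : {v : V // v ≠ a}) (Finset.mem_univ _)]
    · simp
    · intro v _ hv
      exact if_neg fun h' => hv (Subtype.ext h')
  · refine Finset.sum_eq_zero fun v _ => if_neg fun h' => ?_
    exact h (h' ▸ v.2)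

theorem degree_eq (w : V) : G.degree w = (if w ≠ a then 1 else 0)
      + (Finset.univ.filter fun v : {v : V // v ≠ a} => R.par v.1 = w).card := by
  have h1 := R.sum_darts_from (fun _ => 1) w
  rw [Finset.sum_const, Finset.sum_const, nsmul_one, nsmul_one] at h1
  rw [← G.dart_fst_fiber_card_eq_degree w]
  have h2 : (if h : w ≠ a then (1 : ℝ) else 0) = ((if w ≠ a then 1 else 0 : ℕ) : ℝ) := by
    split_ifs <;> simp
  rw [h2] at h1
  exact_mod_cast h1

theorem degree_eq_one_iff {v : V} (hv : v ≠ a) :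
    G.degree v = 1 ↔ ∀ c, c ≠ a → R.par c ≠ v := by
  rw [R.degree_eq, if_pos hv, Nat.add_eq_left, Finset.card_eq_zero, Finset.filter_eq_empty_iff]
  simp

theorem leafCount_eq (ha : G.degree a = 1) : leafCount G =
    (Finset.univ.filter fun v : {v : V // v ≠ a} => G.degree v.1 = 1).card + 1 := by
  rw [leafCount, ← Finset.card_map (Function.Embedding.subtype fun v => v ≠ a),
    ← Finset.card_insert_of_notMem (a := a) (by simp)]
  congr 1
  ext v
  by_cases hv : v = a
  · simp [hv, ha]
  · simp [hv]

end Rooting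

end QuantumGraph

/-! ### The operator on nodal values, and solutions built from vertex data. -/

namespace QuantumGraph

open Real

/-- The solution of `-f'' = k² f` with `f 0 = 0` and `f' 0 = 1`. -/
noncomputable def sinScaled (k t : ℝ) : ℝ := t * sinc (k * t)

section SinScaled

variable (k s t : ℝ)

theorem mul_sinScaled : k * sinScaled k t = sin (k * t) := by
  by_cases h : k * t = 0
  · rw [h, sin_zero, sinScaled, ← mul_assoc, h, zero_mul]
  · rw [sinScaled, sinc_of_ne_zero h]
    have hk := left_ne_zero_of_mul h
    have ht := right_ne_zero_of_mul h
    field_simp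

@[simp] theorem sinScaled_zero_left : sinScaled 0 t = t := by simp [sinScaled]

@[simp] theorem sinScaled_zero_right : sinScaled k 0 = 0 := by simp [sinScaled]

theorem sinScaled_eq_div {k : ℝ} (hk : k ≠ 0) : sinScaled k t = sin (k * t) / k := by
  rw [eq_div_iff hk, mul_comm, mul_sinScaled]

theorem cos_mul_sub : cos (k * (s - t)) =
    cos (k * s) * cos (k * t) + k ^ 2 * sinScaled k s * sinScaled k t := by
  rw [mul_sub, cos_sub, ← mul_sinScaled, ← mul_sinScaled]
  ring

theorem cos_mul_add : cos (k * (s + t)) =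
    cos (k * s) * cos (k * t) - k ^ 2 * sinScaled k s * sinScaled k t := by
  rw [mul_add, cos_add, ← mul_sinScaled, ← mul_sinScaled]
  ring

theorem sinScaled_sub : sinScaled k (s - t) =
    sinScaled k s * cos (k * t) - cos (k * s) * sinScaled k t := by
  by_cases hk : k = 0
  · simp [hk]
  · simp only [sinScaled_eq_div _ hk, mul_sub, sin_sub]
    ring

theorem sinScaled_add : sinScaled k (s + t) =
    sinScaled k s * cos (k * t) + cos (k * s) * sinScaled k t := by
  by_cases hk : k = 0
  · simp [hk]
  · simp only [sinScaled_eq_div _ hk, mul_add, sin_add]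
    ring

theorem cos_sq_add_sinScaled_sq : cos (k * t) ^ 2 + k ^ 2 * sinScaled k t ^ 2 = 1 := by
  rw [← mul_pow, mul_sinScaled, cos_sq_add_sin_sq]

theorem hasDerivAt_cos_mul : HasDerivAt (fun t => cos (k * t)) (-(k ^ 2 * sinScaled k t)) t := by
  refine ((hasDerivAt_id t).const_mul k).cos.congr_deriv ?_
  simp only [id, mul_one]
  rw [← mul_sinScaled]
  ring

theorem hasDerivAt_sinScaled : HasDerivAt (sinScaled k) (cos (k * t)) t := by
  by_cases hk : k = 0
  · subst hk
    simpa [funext sinScaled_zero_left] using hasDerivAt_id' t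
  · have h1 := (((hasDerivAt_id t).const_mul k).sin).div_const k
    have h2 : (fun t => sin (k * id t) / k) = sinScaled k :=
      funext fun t => (sinScaled_eq_div t hk).symm
    rw [h2] at h1
    refine h1.congr_deriv ?_
    simp only [id]
    field_simp

theorem sinScaled_pos {k t : ℝ} (hk : 0 ≤ k) (ht : 0 < t) (h : k * t < π) : 0 < sinScaled k t := by
  rcases hk.eq_or_lt with rfl | hk
  · simpa using ht
  · rw [sinScaled_eq_div _ hk.ne']
    exact div_pos (sin_pos_of_pos_of_lt_pi (by positivity) h) hk

/-- The form t sinc(k t) covers k = 0, where the path of operators starts and solutions are affine.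
-/
theorem continuous_sinScaled_left : Continuous fun k => sinScaled k t := by
  unfold sinScaled
  exact continuous_const.mul (continuous_sinc.comp (continuous_id.mul continuous_const))

end SinScaled

section Slope

variable {I : Type*} (par : I → Option I) (h : I → ℝ) (k : ℝ)

/-- The derivative at the lower end of edge `i`, pointing upwards, of the solution with vertex
values `x`. -/
noncomputable def slopeUp (x : EuclideanSpace ℝ (Option I)) (i : I) : ℝ :=
  (x (par i) - cos (k * h i) * x (some i)) / sinScaled k (h i)

/-- The derivative at the upper end of edge `i`, pointing downwards, of the solution with vertex
values `x`. -/
noncomputable def slopeDown (x : EuclideanSpace ℝ (Option I)) (i : I) : ℝ :=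
  (x (some i) - cos (k * h i) * x (par i)) / sinScaled k (h i)

variable {par h k}

theorem slopeUp_add (x y : EuclideanSpace ℝ (Option I)) (i : I) :
    slopeUp par h k (x + y) i = slopeUp par h k x i + slopeUp par h k y i := by
  simp only [slopeUp, PiLp.add_apply]
  ring

theorem slopeDown_add (x y : EuclideanSpace ℝ (Option I)) (i : I) :
    slopeDown par h k (x + y) i = slopeDown par h k x i + slopeDown par h k y i := by
  simp only [slopeDown, PiLp.add_apply]
  ring

theorem slopeUp_smul (r : ℝ) (x : EuclideanSpace ℝ (Option I)) (i : I) :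
    slopeUp par h k (r • x) i = r * slopeUp par h k x i := by
  simp only [slopeUp, PiLp.smul_apply, smul_eq_mul]
  ring

theorem slopeDown_smul (r : ℝ) (x : EuclideanSpace ℝ (Option I)) (i : I) :
    slopeDown par h k (r • x) i = r * slopeDown par h k x i := by
  simp only [slopeDown, PiLp.smul_apply, smul_eq_mul]
  ring

end Slope

section TreeOperator

variable {I : Type*} [Fintype I] [DecidableEq I] (par : I → Option I) (h : I → ℝ) (k : ℝ)

/-- The operator sending vertex values to the negative sums of outward derivatives. -/
noncomputable def treeOperator :
    EuclideanSpace ℝ (Option I) →L[ℝ] EuclideanSpace ℝ (Option I) :=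
  LinearMap.toContinuousLinearMap
    { toFun := fun x => WithLp.toLp 2 fun w =>
        -(w.elim 0 (slopeUp par h k x)) - ∑ c with par c = w, slopeDown par h k x c
      map_add' := fun x y => by
        ext w
        simp only [PiLp.add_apply, slopeDown_add, Finset.sum_add_distrib]
        rcases w with _ | i
        · simp only [Option.elim_none]
          ring
        · simp only [Option.elim_some, slopeUp_add]
          ring
      map_smul' := fun r x => by
        ext w
        simp only [PiLp.smul_apply, slopeDown_smul, ← Finset.mul_sum, RingHom.id_apply, smul_eq_mul]
        rcases w with _ | i
        · simp only [Option.elim_none]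
          ring
        · simp only [Option.elim_some, slopeUp_smul]
          ring }

theorem treeOperator_apply (x : EuclideanSpace ℝ (Option I)) (w : Option I) :
    treeOperator par h k x w =
      -(w.elim 0 (slopeUp par h k x)) - ∑ c with par c = w, slopeDown par h k x c := rfl

/-- Regrouping vertex sums by edges. Each edge contributes its polarised form ∫ f'g' - k² f g, which
is visibly symmetric, and nonnegative on the diagonal at k = 0. -/
theorem inner_treeOperator (x y : EuclideanSpace ℝ (Option I)) :
    inner ℝ (treeOperator par h k x) y =
      ∑ i, ((x (some i) * y (some i) + x (par i) * y (par i)) * cos (k * h i)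
        - x (some i) * y (par i) - x (par i) * y (some i)) / sinScaled k (h i) := by
  have h1 : inner ℝ (treeOperator par h k x) y = ∑ w, y w * treeOperator par h k x w := by
    simp [PiLp.inner_apply]
  have h2 : ∑ w, y w * ∑ c with par c = w, slopeDown par h k x c
      = ∑ c, y (par c) * slopeDown par h k x c := by
    rw [← Finset.sum_fiberwise Finset.univ par]
    refine Finset.sum_congr rfl fun w _ => ?_
    rw [Finset.mul_sum]
    refine Finset.sum_congr rfl fun c hc => ?_
    rw [(Finset.mem_filter.1 hc).2]
  rw [h1]
  simp only [treeOperator_apply, mul_sub, Finset.sum_sub_distrib, h2]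
  rw [Fintype.sum_option]
  simp only [Option.elim_none, Option.elim_some, neg_zero, mul_zero, zero_add]
  rw [← Finset.sum_sub_distrib]
  refine Finset.sum_congr rfl fun i _ => ?_
  simp only [slopeUp, slopeDown]
  ring

theorem treeOperator_isSymmetric : (treeOperator par h k).toLinearMap.IsSymmetric := by
  intro x y
  rw [real_inner_comm _ x]
  simp only [ContinuousLinearMap.coe_coe, inner_treeOperator]
  exact Finset.sum_congr rfl fun i _ => by ring

theorem treeOperator_zero_nonneg (hh : ∀ i, 0 < h i) (x : EuclideanSpace ℝ (Option I)) :
    0 ≤ inner ℝ (treeOperator par h 0 x) x := by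
  rw [inner_treeOperator]
  refine Finset.sum_nonneg fun i _ => div_nonneg ?_ (by simpa using (hh i).le)
  simp only [zero_mul, cos_zero]
  nlinarith [sq_nonneg (x (some i) - x (par i))]

theorem continuousOn_treeOperator {K : ℝ} (hh : ∀ i, 0 < h i) (hK : ∀ i, K * h i < π) :
    ContinuousOn (treeOperator par h) (Set.Icc 0 K) := by
  have hS : ∀ i, ∀ k ∈ Set.Icc 0 K, sinScaled k (h i) ≠ 0 := fun i k hk =>
    (sinScaled_pos hk.1 (hh i)
      (lt_of_le_of_lt (mul_le_mul_of_nonneg_right hk.2 (hh i).le) (hK i))).ne'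
  have hc : ∀ i, Continuous fun k => cos (k * h i) := fun i =>
    continuous_cos.comp (continuous_id.mul continuous_const)
  have hup : ∀ x i, ContinuousOn (fun k => slopeUp par h k x i) (Set.Icc 0 K) := fun x i =>
    (continuous_const.sub ((hc i).mul continuous_const)).continuousOn.div
      (continuous_sinScaled_left _).continuousOn (hS i)
  have hdown : ∀ x i, ContinuousOn (fun k => slopeDown par h k x i) (Set.Icc 0 K) := fun x i =>
    (continuous_const.sub ((hc i).mul continuous_const)).continuousOn.div
      (continuous_sinScaled_left _).continuousOn (hS i)
  rw [continuousOn_clm_apply]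
  intro x
  have hpi : ContinuousOn (fun k w => (treeOperator par h k x) w) (Set.Icc 0 K) := by
    refine continuousOn_pi.2 fun w => ?_
    simp only [treeOperator_apply]
    refine ContinuousOn.sub ?_ (continuousOn_finsetSum _ fun c _ => hdown x c)
    rcases w with _ | i
    · simp only [Option.elim_none, neg_zero]
      fun_prop
    · exact ContinuousOn.neg (f := fun k => slopeUp par h k x i) (hup x i)
  exact (PiLp.continuous_toLp 2 fun _ : Option I => ℝ).comp_continuousOn hpi

/-- The sum of the dimensions of the solution spaces with parameter in `[0, K]`. -/
theorem exists_finset_sum_finrank_ker_treeOperator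
    (hwf : WellFounded fun c w : Option I => ∃ i, c = some i ∧ par i = w)
    (hroot : ∃ i, par i = none) {K : ℝ} (hK : 0 < K) (hh : ∀ i, 0 < h i) (hKh : ∀ i, K * h i < π)
    (j : ℕ) (hsum : (j + (((Finset.univ.filter fun i : I => ∀ c, par c ≠ some i).card : ℝ) - 1) / 2)
      * π ≤ K * ∑ i, h i) :
    ∃ S : Finset ℝ, (∀ k ∈ S, k ∈ Set.Icc 0 K) ∧
      j + 1 ≤ ∑ k ∈ S, Module.finrank ℝ (LinearMap.ker (treeOperator par h k).toLinearMap) := by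
  rw [Finset.mul_sum] at hsum
  obtain ⟨U, hU, hform⟩ := exists_nonpos_subspace hwf hroot
    (fun i => ⟨mul_pos hK (hh i), hKh i⟩) j hsum
  obtain ⟨S, hS, hle⟩ := exists_finset_finrank_le_sum_finrank_ker (treeOperator par h) hK.le
    (continuousOn_treeOperator par h hh hKh) (treeOperator_isSymmetric par h)
    (treeOperator_zero_nonneg par h hh) U fun x hx => by
      rw [inner_treeOperator]
      refine le_of_eq_of_le ?_ (mul_nonpos_of_nonneg_of_nonpos hK.le (hform x hx))
      rw [Finset.mul_sum]
      refine Finset.sum_congr rfl fun i _ => ?_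
      rw [sinScaled_eq_div _ hK.ne', div_div_eq_mul_div]
      ring
  exact ⟨S, hS, hU.trans hle⟩

end TreeOperator

section Solution

variable {V : Type*} {G : SimpleGraph V} {ℓ : EdgeMetric G}

/-- The function with value `c v` at the vertex `v` and derivative `s d` at the beginning of the
oriented edge `d` that solves `-f'' = k² f` on all edges. -/
noncomputable def solution (ℓ : EdgeMetric G) (k : ℝ) (c : V → ℝ) (s : G.Dart → ℝ)
    (p : MetricGraph ℓ) : ℝ :=
  c (Quot.out p).1.fst * cos (k * (Quot.out p).2)
    + s (Quot.out p).1 * sinScaled k (Quot.out p).2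

/-- `h1` and `h2` say that the data at both ends of an edge describe the same function. The formula
then respects the gluing, and the representative chosen by `Quot.out` is irrelevant. -/
theorem solution_mk {k : ℝ} {c : V → ℝ} {s : G.Dart → ℝ}
    (h1 : ∀ d : G.Dart, c d.snd = c d.fst * cos (k * ℓ.dartLength d)
      + s d * sinScaled k (ℓ.dartLength d))
    (h2 : ∀ d : G.Dart, s d.symm = k ^ 2 * c d.fst * sinScaled k (ℓ.dartLength d)
      - s d * cos (k * ℓ.dartLength d)) (q : PrePoint ℓ) :
    solution ℓ k c s (MetricGraph.mk q)
      = c q.1.fst * cos (k * q.2) + s q.1 * sinScaled k q.2 := by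
  let F : PrePoint ℓ → ℝ := fun q => c q.1.fst * cos (k * q.2) + s q.1 * sinScaled k q.2
  have hF : ∀ p q, Glue ℓ p q → F p = F q := by
    rintro ⟨d, x⟩ ⟨e, y⟩ (⟨h, h'⟩ | ⟨h, hx, hy⟩)
    · simp only at h h'
      subst h
      simp only [F, h']
      have h3 : c d.symm.fst = c d.snd := rfl
      rw [h3, h1, h2, cos_mul_sub, sinScaled_sub]
      linear_combination -(c d.fst * cos (k * x) + s d * sinScaled k x)
        * cos_sq_add_sinScaled_sq k (ℓ.dartLength d)
    · simp only at h hx hy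
      simp [F, hx, hy, h]
  have h3 : Quot.lift F hF (Quot.mk _ (Quot.out (MetricGraph.mk q : MetricGraph ℓ)))
      = Quot.lift F hF (Quot.mk _ q) :=
    congrArg (Quot.lift F hF) (Quot.out_eq (MetricGraph.mk q : MetricGraph ℓ))
  exact h3

theorem onEdge_solution {k : ℝ} {c : V → ℝ} {s : G.Dart → ℝ}
    (h1 : ∀ d : G.Dart, c d.snd = c d.fst * cos (k * ℓ.dartLength d)
      + s d * sinScaled k (ℓ.dartLength d))
    (h2 : ∀ d : G.Dart, s d.symm = k ^ 2 * c d.fst * sinScaled k (ℓ.dartLength d)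
      - s d * cos (k * ℓ.dartLength d)) (d : G.Dart) {x : ℝ}
    (hx : x ∈ Set.Icc 0 (ℓ.dartLength d)) :
    onEdge (solution ℓ k c s) d x = c d.fst * cos (k * x) + s d * sinScaled k x := by
  rw [onEdge_apply _ d hx, solution_mk h1 h2]

theorem solution_solvesNeumann [Fintype V] [DecidableEq V] [DecidableRel G.Adj] {k : ℝ}
    {c : V → ℝ} {s : G.Dart → ℝ}
    (h1 : ∀ d : G.Dart, c d.snd = c d.fst * cos (k * ℓ.dartLength d)
      + s d * sinScaled k (ℓ.dartLength d))
    (h2 : ∀ d : G.Dart, s d.symm = k ^ 2 * c d.fst * sinScaled k (ℓ.dartLength d)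
      - s d * cos (k * ℓ.dartLength d))
    (h3 : ∀ v, ∑ d : G.Dart with d.fst = v, s d = 0) :
    SolvesNeumann (k ^ 2) (solution ℓ k c s) := by
  have hderiv : ∀ (d : G.Dart) (x : ℝ),
      HasDerivAt (fun x => c d.fst * cos (k * x) + s d * sinScaled k x)
        (-(k ^ 2 * c d.fst * sinScaled k x) + s d * cos (k * x)) x := fun d x => by
    refine (((hasDerivAt_cos_mul k x).const_mul _).add
      ((hasDerivAt_sinScaled k x).const_mul _)).congr_deriv ?_
    ring
  refine ⟨?_, fun d x => -(k ^ 2 * c d.fst * sinScaled k x) + s d * cos (k * x),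
    fun d x hx => ⟨?_, ?_⟩, fun v => ?_⟩
  · have : Continuous (solution ℓ k c s ∘ MetricGraph.mk) := by
      rw [show solution ℓ k c s ∘ MetricGraph.mk = fun q : PrePoint ℓ =>
        c q.1.fst * cos (k * q.2) + s q.1 * sinScaled k q.2 from funext (solution_mk h1 h2)]
      refine continuous_sigma fun d => ?_
      have : Continuous fun x => c d.fst * cos (k * x) + s d * sinScaled k x :=
        continuous_iff_continuousAt.2 fun x => (hderiv d x).continuousAt
      exact this.comp continuous_subtype_val
    exact continuous_quot_lift (fun p q h => congrArg (solution ℓ k c s)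
      (MetricGraph.mk_eq_mk h)) this |>.congr fun p => by
        obtain ⟨q, rfl⟩ := MetricGraph.exists_mk p
        rfl
  · exact (hderiv d x).hasDerivWithinAt.congr (fun y hy => onEdge_solution h1 h2 d hy)
      (onEdge_solution h1 h2 d hx)
  · rw [onEdge_solution h1 h2 d hx]
    refine (((hasDerivAt_sinScaled k x).const_mul (k ^ 2 * c d.fst)).neg.add
      ((hasDerivAt_cos_mul k x).const_mul (s d))).hasDerivWithinAt.congr_deriv ?_
    ring
  · simpa using h3 v

/-- Solution spaces for different parameters are independent. -/
theorem sum_finrank_le_rank_eigenspan [Fintype V] [DecidableEq V] [DecidableRel G.Adj]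
    {S : Finset ℝ} {K : ℝ} (hS : ∀ k ∈ S, k ∈ Set.Icc 0 K) {M : ℝ → Type*}
    [∀ k, AddCommGroup (M k)] [∀ k, Module ℝ (M k)] [∀ k, FiniteDimensional ℝ (M k)]
    (F : ∀ k, M k →ₗ[ℝ] (MetricGraph ℓ → ℝ)) (hF : ∀ k ∈ S, Function.Injective (F k))
    (hFS : ∀ k ∈ S, ∀ x, F k x ∈ eigenspace ℓ (k ^ 2)) :
    ((∑ k ∈ S, Module.finrank ℝ (M k) : ℕ) : Cardinal)
      ≤ Module.rank ℝ (eigenspan ℓ (Set.Iic (K ^ 2))) := by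
  classical
  have hmem : ∀ k ∈ S, ∀ x, F k x ∈ eigenspan ℓ (Set.Iic (K ^ 2)) := fun k hk x => by
    have h1 : k ^ 2 ∈ Set.Iic (K ^ 2) := pow_le_pow_left₀ (hS k hk).1 (hS k hk).2 2
    exact (le_iSup₂ (f := fun lam (_ : lam ∈ Set.Iic (K ^ 2)) => eigenspace ℓ lam) _ h1)
      (hFS k hk x)
  let Φ : (∀ k : S, M k) →ₗ[ℝ] eigenspan ℓ (Set.Iic (K ^ 2)) :=
    ∑ k : S, ((F k).codRestrict _ (hmem k k.2)) ∘ₗ LinearMap.proj k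
  have hΦ : ∀ x, (Φ x : MetricGraph ℓ → ℝ) = ∑ k : S, F k (x k) := fun x => by
    simp [Φ, LinearMap.sum_apply]
  -- Pairing a vanishing sum with one summand leaves only the norm of that summand: distinct k ≥ 0
  -- have distinct squares, so the others are orthogonal to it.
  have hinj : Function.Injective Φ := by
    rw [← LinearMap.ker_eq_bot, LinearMap.ker_eq_bot']
    intro x hx
    have h0 : ∑ k : S, F k (x k) = 0 := by
      rw [← hΦ, hx]
      rfl
    have hsol : ∀ k : S, SolvesNeumann ((k : ℝ) ^ 2) (F k (x k)) := fun k => hFS k k.2 _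
    funext k
    refine hF k k.2 ?_
    rw [Pi.zero_apply, map_zero]
    by_contra hne
    have h1 := edgeInner_self_pos (hsol k).1 hne
    have h2 : edgeInner (F k (x k)) (∑ i : S, F i (x i)) = 0 := by
      rw [h0]
      simp [edgeInner, onEdge]
    rw [edgeInner_sum _ (hsol k).1 fun i _ => (hsol i).1,
      Finset.sum_eq_single_of_mem k (Finset.mem_univ k) fun i _ hik => ?_] at h2
    · exact h1.ne' h2
    · refine (hsol k).edgeInner_eq_zero (hsol i) fun h => hik (Subtype.ext ?_)
      exact ((pow_left_inj₀ (hS k k.2).1 (hS i i.2).1 two_ne_zero).1 h).symm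
  have h1 := LinearMap.lift_rank_le_of_injective Φ hinj
  rw [← Module.finrank_eq_rank, Module.finrank_pi_fintype, Finset.sum_coe_sort S
    (fun k => Module.finrank ℝ (M k))] at h1
  simpa only [Cardinal.lift_natCast, Cardinal.nat_le_lift_iff] using h1

end Solution

end QuantumGraph

/-! ### Subdivision of the tree and the upper bound. -/

namespace QuantumGraph

open Real

namespace Rooting

variable {V : Type*} {G : SimpleGraph V} {a : V} (R : Rooting G a) (ℓ : EdgeMetric G) (n : ℕ)

section Mesh

open Classical in
/-- The node at a vertex, in the subdivision of every edge into `n + 1` equal parts. -/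
noncomputable def node (a u : V) : Option ({v : V // v ≠ a} × Fin (n + 1)) :=
  if h : u ≠ a then some (⟨u, h⟩, 0) else none

theorem node_val (v : {v : V // v ≠ a}) : node n a v.1 = some (v, 0) := dif_pos v.2

theorem node_root : node n a a = none := dif_neg (by simp)

theorem node_eq_some {u : V} {v : {v : V // v ≠ a}} {m : Fin (n + 1)} :
    node n a u = some (v, m) ↔ u = v ∧ m = 0 := by
  unfold node
  split_ifs with h
  · simp only [Option.some.injEq, Prod.mk.injEq, Subtype.ext_iff]
    exact and_congr_right fun _ => eq_comm
  · simp only [false_iff, not_and]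
    intro h'
    exact absurd (h' ▸ v.2) h

theorem node_injective : Function.Injective (node n a) := by
  intro u v huv
  by_cases hv : v = a
  · subst hv
    by_contra hu
    rw [node_root, node, dif_pos hu] at huv
    cases huv
  · rw [node_val n ⟨v, hv⟩, node_eq_some] at huv
    exact huv.1

/-- The next node on the way to the root. -/
noncomputable def meshPar (i : {v : V // v ≠ a} × Fin (n + 1)) :
    Option ({v : V // v ≠ a} × Fin (n + 1)) :=
  if h : (i.2 : ℕ) + 1 < n + 1 then some (i.1, ⟨i.2 + 1, h⟩) else node n a (R.par i.1)

theorem meshPar_of_lt (v : {v : V // v ≠ a}) {m : ℕ} (h : m + 1 < n + 1) :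
    R.meshPar n (v, ⟨m, by omega⟩) = some (v, ⟨m + 1, h⟩) := dif_pos h

theorem meshPar_last (v : {v : V // v ≠ a}) :
    R.meshPar n (v, Fin.last n) = node n a (R.par v) := dif_neg (by simp)

theorem meshPar_eq_some_succ {c : {v : V // v ≠ a} × Fin (n + 1)} {v : {v : V // v ≠ a}} {m : ℕ}
    (h : m + 1 < n + 1) :
    R.meshPar n c = some (v, ⟨m + 1, h⟩) ↔ c = (v, ⟨m, by omega⟩) := by
  obtain ⟨u, l, hl⟩ := c
  unfold meshPar
  split_ifs with h'
  · simp [Prod.ext_iff, Fin.ext_iff]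
  · rw [node_eq_some]
    simp only [Fin.ext_iff, Fin.val_zero, Nat.add_eq_zero_iff, one_ne_zero, and_false, false_iff,
      Prod.mk.injEq, not_and]
    intro _
    simp only at h'
    omega

theorem meshPar_eq_node {c : {v : V // v ≠ a} × Fin (n + 1)} {u : V} :
    R.meshPar n c = node n a u ↔ c.2 = Fin.last n ∧ R.par c.1 = u := by
  obtain ⟨v, l, hl⟩ := c
  unfold meshPar
  split_ifs with h'
  · simp only at h'
    rw [eq_comm, node_eq_some]
    simp only [Fin.ext_iff, Fin.val_zero, Nat.add_eq_zero_iff, one_ne_zero, and_false, Fin.val_last,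
      false_iff, not_and]
    omega
  · simp only at h'
    rw [(node_injective n).eq_iff]
    simp only [Fin.ext_iff, Fin.val_last]
    constructor
    · exact fun h => ⟨by omega, h⟩
    · exact fun h => h.2

/-- The distance to the root, counted in mesh steps, drops at every passage to the parent. Children
must come first, so the measure is a fixed bound minus that distance. -/
theorem meshPar_wellFounded [Finite V] : WellFounded
    fun c w : Option ({v : V // v ≠ a} × Fin (n + 1)) => ∃ i, c = some i ∧ R.meshPar n i = w := by
  classical
  have := Fintype.ofFinite V
  let r : Option ({v : V // v ≠ a} × Fin (n + 1)) → ℕ := fun w =>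
    w.elim 0 fun i => G.dist a i.1 * (n + 1) - i.2
  have hnode : ∀ u, r (node n a u) = G.dist a u * (n + 1) := by
    intro u
    by_cases hu : u = a
    · subst hu
      simp [node_root, r]
    · rw [node_val n ⟨u, hu⟩]
      simp [r]
  have hr : ∀ i, r (R.meshPar n i) < r (some i) := by
    rintro ⟨v, m, hm⟩
    have h1 := R.dist v v.2
    have h2 : r (some (v, ⟨m, hm⟩)) = G.dist a (R.par v) * (n + 1) + (n + 1) - m := by
      simp only [r, Option.elim_some, h1]
      rw [add_mul, one_mul]
    by_cases h : m + 1 < n + 1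
    · rw [R.meshPar_of_lt n v h, h2]
      simp only [r, Option.elim_some, h1]
      rw [add_mul, one_mul]
      omega
    · have h3 : (⟨m, hm⟩ : Fin (n + 1)) = Fin.last n := Fin.ext (by simp only [Fin.val_last]; omega)
      rw [h2, h3, meshPar_last, hnode]
      omega
  have hB : ∀ w, r w ≤ ∑ w, r w := fun w => Finset.single_le_sum (fun _ _ => Nat.zero_le _)
    (Finset.mem_univ w)
  refine Subrelation.wf ?_ (measure fun w => (∑ w, r w) - r w).wf
  rintro c w ⟨i, rfl, rfl⟩
  have := hr i
  have := hB (some i)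
  change (∑ w, r w) - r (some i) < (∑ w, r w) - r (R.meshPar n i)
  omega

/-- The length of the parts of an edge. -/
noncomputable def meshStep (i : {v : V // v ≠ a} × Fin (n + 1)) : ℝ :=
  ℓ.dartLength (R.up i.1) / (n + 1)

theorem meshStep_pos (i : {v : V // v ≠ a} × Fin (n + 1)) : 0 < R.meshStep ℓ n i :=
  div_pos (ℓ.dartLength_pos _) (by positivity)

variable [Fintype V] [DecidableEq V] [DecidableRel G.Adj]

theorem sum_meshStep : ∑ i, R.meshStep ℓ n i = ℓ.totalLength := by
  rw [R.totalLength_eq, Fintype.sum_prod_type]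
  refine Finset.sum_congr rfl fun v _ => ?_
  simp only [meshStep, Finset.sum_const, Finset.card_univ, Fintype.card_fin, nsmul_eq_mul]
  push_cast
  field_simp

/-- The nodes added by subdivision have a child, so the childless nodes are the leaves of G other
than the root; the root is the extra 1. -/
theorem card_mesh_leaves (ha : G.degree a = 1) :
    (Finset.univ.filter fun i : {v : V // v ≠ a} × Fin (n + 1) =>
      ∀ c, R.meshPar n c ≠ some i).card + 1 = leafCount G := by
  rw [leafCount_eq ha]
  congr 1
  symm
  refine Finset.card_bij (fun v _ => (v, 0)) ?_ ?_ ?_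
  · intro v hv
    simp only [Finset.mem_filter, Finset.mem_univ, true_and] at hv ⊢
    intro c hc
    rw [← node_val n v, meshPar_eq_node] at hc
    exact (R.degree_eq_one_iff v.2).1 hv c.1 c.1.2 hc.2
  · intro v _ w _ h
    exact congrArg Prod.fst h
  · rintro ⟨v, m, hm⟩ hi
    simp only [Finset.mem_filter, Finset.mem_univ, true_and] at hi
    rcases m with _ | m
    · refine ⟨v, ?_, rfl⟩
      simp only [Finset.mem_filter, Finset.mem_univ, true_and]
      refine (R.degree_eq_one_iff v.2).2 fun c hc hcv => hi (⟨c, hc⟩, Fin.last n) ?_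
      rw [meshPar_last, hcv]
      exact node_val n v
    · exact absurd (R.meshPar_of_lt n v hm) (hi _)

end Mesh

section Kernel

variable {ℓ n} {k : ℝ} (x : EuclideanSpace ℝ (Option ({v : V // v ≠ a} × Fin (n + 1))))

variable (ℓ k) in
/-- The derivatives at the beginning of the oriented edges of the solution with mesh values `x`. -/
noncomputable def dartSlope (d : G.Dart) : ℝ :=
  Sum.elim (fun v => slopeUp (R.meshPar n) (R.meshStep ℓ n) k x (v, 0))
    (fun v => slopeDown (R.meshPar n) (R.meshStep ℓ n) k x (v, Fin.last n)) (R.dartEquiv.symm d)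

theorem dartSlope_up (v : {v : V // v ≠ a}) : R.dartSlope ℓ k x (R.up v)
    = slopeUp (R.meshPar n) (R.meshStep ℓ n) k x (v, 0) := by
  have : R.dartEquiv.symm (R.up v) = Sum.inl v := R.dartEquiv.symm_apply_apply (Sum.inl v)
  rw [dartSlope, this, Sum.elim_inl]

theorem dartSlope_up_symm (v : {v : V // v ≠ a}) : R.dartSlope ℓ k x (R.up v).symm
    = slopeDown (R.meshPar n) (R.meshStep ℓ n) k x (v, Fin.last n) := by
  have : R.dartEquiv.symm (R.up v).symm = Sum.inr v := R.dartEquiv.symm_apply_apply (Sum.inr v)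
  rw [dartSlope, this, Sum.elim_inr]

variable [Fintype V] [DecidableEq V] {x}

theorem slope_add_slope_eq_zero (hx : treeOperator (R.meshPar n) (R.meshStep ℓ n) k x = 0)
    (v : {v : V // v ≠ a}) {m : ℕ} (h : m + 1 < n + 1) :
    slopeUp (R.meshPar n) (R.meshStep ℓ n) k x (v, ⟨m + 1, h⟩)
      = -slopeDown (R.meshPar n) (R.meshStep ℓ n) k x (v, ⟨m, by omega⟩) := by
  have h1 := congrArg (fun y : EuclideanSpace ℝ _ => y (some (v, ⟨m + 1, h⟩))) hx
  simp only [treeOperator_apply, PiLp.zero_apply, Option.elim_some] at h1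
  have h2 : (Finset.univ.filter fun c => R.meshPar n c = some (v, ⟨m + 1, h⟩))
      = {(v, ⟨m, by omega⟩)} := by
    ext c
    simp [R.meshPar_eq_some_succ n h]
  rw [h2, Finset.sum_singleton] at h1
  linarith

theorem sum_slope_node_eq_zero [DecidableRel G.Adj]
    (hx : treeOperator (R.meshPar n) (R.meshStep ℓ n) k x = 0) (u : V) :
    ∑ d : G.Dart with d.fst = u, R.dartSlope ℓ k x d = 0 := by
  have h1 := congrArg (fun y : EuclideanSpace ℝ _ => y (node n a u)) hx
  simp only [treeOperator_apply, PiLp.zero_apply] at h1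
  rw [R.sum_darts_from]
  have h2 : ∑ c with R.meshPar n c = node n a u,
      slopeDown (R.meshPar n) (R.meshStep ℓ n) k x c
      = ∑ v with R.par v.1 = u, R.dartSlope ℓ k x (R.up v).symm := by
    symm
    refine Finset.sum_bij (fun v _ => (v, Fin.last n)) ?_ ?_ ?_ ?_
    · intro v hv
      simpa [R.meshPar_eq_node] using hv
    · intro v _ w _ h
      exact congrArg Prod.fst h
    · rintro ⟨v, m⟩ hc
      simp only [R.meshPar_eq_node, Finset.mem_filter, Finset.mem_univ, true_and] at hc
      exact ⟨v, by simpa using hc.2, by rw [hc.1]⟩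
    · intro v _
      rw [dartSlope_up_symm]
  have h3 : (node n a u).elim 0 (slopeUp (R.meshPar n) (R.meshStep ℓ n) k x)
      = if h : u ≠ a then R.dartSlope ℓ k x (R.up ⟨u, h⟩) else 0 := by
    split_ifs with h
    · rw [node_val n ⟨u, h⟩, Option.elim_some, dartSlope_up]
    · rw [not_not.1 h, node_root, Option.elim_none]
  rw [← h3, ← h2]
  linarith

/-- The kernel equation at an inner mesh node matches the slopes of the two adjacent pieces, so by
induction on the pieces all of them belong to one solution along the whole edge. -/
theorem mesh_values (hx : treeOperator (R.meshPar n) (R.meshStep ℓ n) k x = 0)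
    (v : {v : V // v ≠ a}) (hS : sinScaled k (R.meshStep ℓ n (v, 0)) ≠ 0) {m : ℕ}
    (hm : m < n + 1) :
    x (some (v, ⟨m, hm⟩)) = x (some (v, 0)) * cos (k * (m * R.meshStep ℓ n (v, 0)))
        + R.dartSlope ℓ k x (R.up v) * sinScaled k (m * R.meshStep ℓ n (v, 0)) ∧
    x (R.meshPar n (v, ⟨m, hm⟩))
        = x (some (v, 0)) * cos (k * ((m + 1) * R.meshStep ℓ n (v, 0)))
        + R.dartSlope ℓ k x (R.up v) * sinScaled k ((m + 1) * R.meshStep ℓ n (v, 0)) ∧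
    slopeDown (R.meshPar n) (R.meshStep ℓ n) k x (v, ⟨m, hm⟩)
        = k ^ 2 * x (some (v, 0)) * sinScaled k ((m + 1) * R.meshStep ℓ n (v, 0))
        - R.dartSlope ℓ k x (R.up v) * cos (k * ((m + 1) * R.meshStep ℓ n (v, 0))) := by
  set h := R.meshStep ℓ n (v, 0) with hh
  have hstep : ∀ m, R.meshStep ℓ n (v, m) = h := fun m => rfl
  have hsq := cos_sq_add_sinScaled_sq k h
  have key : ∀ (X Y : ℝ) (m : ℕ) (hm : m < n + 1),
      x (some (v, ⟨m, hm⟩)) = X * cos (k * (m * h)) + Y * sinScaled k (m * h) →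
      slopeUp (R.meshPar n) (R.meshStep ℓ n) k x (v, ⟨m, hm⟩)
        = -(k ^ 2 * X * sinScaled k (m * h)) + Y * cos (k * (m * h)) →
      x (R.meshPar n (v, ⟨m, hm⟩)) = X * cos (k * ((m + 1) * h))
        + Y * sinScaled k ((m + 1) * h) ∧
      slopeDown (R.meshPar n) (R.meshStep ℓ n) k x (v, ⟨m, hm⟩)
        = k ^ 2 * X * sinScaled k ((m + 1) * h) - Y * cos (k * ((m + 1) * h)) := by
    intro X Y m hm h1 h2
    have h3 : x (R.meshPar n (v, ⟨m, hm⟩))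
        = cos (k * h) * x (some (v, ⟨m, hm⟩)) + sinScaled k h
          * slopeUp (R.meshPar n) (R.meshStep ℓ n) k x (v, ⟨m, hm⟩) := by
      rw [slopeUp, hstep]
      field_simp
      ring
    have h4 : slopeDown (R.meshPar n) (R.meshStep ℓ n) k x (v, ⟨m, hm⟩)
        = k ^ 2 * sinScaled k h * x (some (v, ⟨m, hm⟩)) - cos (k * h)
          * slopeUp (R.meshPar n) (R.meshStep ℓ n) k x (v, ⟨m, hm⟩) := by
      rw [slopeDown, hstep, div_eq_iff hS, h3]
      linear_combination -x (some (v, ⟨m, hm⟩)) * hsq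
    rw [h3, h4, h1, h2, add_mul, one_mul, cos_mul_add, sinScaled_add]
    constructor <;> ring
  have main : ∀ (m : ℕ) (hm : m < n + 1),
      x (some (v, ⟨m, hm⟩)) = x (some (v, 0)) * cos (k * (m * h))
        + R.dartSlope ℓ k x (R.up v) * sinScaled k (m * h) ∧
      slopeUp (R.meshPar n) (R.meshStep ℓ n) k x (v, ⟨m, hm⟩)
        = -(k ^ 2 * x (some (v, 0)) * sinScaled k (m * h))
          + R.dartSlope ℓ k x (R.up v) * cos (k * (m * h)) := by
    intro m
    induction m with
    | zero =>
      intro hm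
      have h0 : (⟨0, hm⟩ : Fin (n + 1)) = 0 := rfl
      rw [h0, dartSlope_up]
      simp
    | succ m ih =>
      intro hm
      obtain ⟨h1, h2⟩ := ih (by omega)
      obtain ⟨h3, h4⟩ := key _ _ m (by omega) h1 h2
      rw [R.meshPar_of_lt n v hm] at h3
      rw [R.slope_add_slope_eq_zero hx v hm, h3, h4]
      push_cast
      exact ⟨rfl, by ring⟩
  obtain ⟨h1, h2⟩ := main m hm
  exact ⟨h1, key _ _ m hm h1 h2⟩

theorem mesh_values_end (hx : treeOperator (R.meshPar n) (R.meshStep ℓ n) k x = 0)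
    (v : {v : V // v ≠ a}) (hS : sinScaled k (R.meshStep ℓ n (v, 0)) ≠ 0) :
    x (node n a (R.par v)) = x (node n a v) * cos (k * ℓ.dartLength (R.up v))
      + R.dartSlope ℓ k x (R.up v) * sinScaled k (ℓ.dartLength (R.up v)) ∧
    R.dartSlope ℓ k x (R.up v).symm = k ^ 2 * x (node n a v) * sinScaled k (ℓ.dartLength (R.up v))
      - R.dartSlope ℓ k x (R.up v) * cos (k * ℓ.dartLength (R.up v)) := by
  have h1 := (R.mesh_values hx v hS (Nat.lt_succ_self n)).2
  have h2 : ((n : ℝ) + 1) * R.meshStep ℓ n (v, 0) = ℓ.dartLength (R.up v) := by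
    rw [meshStep]
    field_simp
  rw [h2] at h1
  rw [dartSlope_up_symm, node_val n v, ← R.meshPar_last n v]
  exact h1

theorem mesh_compatible (hx : treeOperator (R.meshPar n) (R.meshStep ℓ n) k x = 0)
    (hS : ∀ i, sinScaled k (R.meshStep ℓ n i) ≠ 0) (d : G.Dart) :
    x (node n a d.snd) = x (node n a d.fst) * cos (k * ℓ.dartLength d)
      + R.dartSlope ℓ k x d * sinScaled k (ℓ.dartLength d) ∧
    R.dartSlope ℓ k x d.symm = k ^ 2 * x (node n a d.fst) * sinScaled k (ℓ.dartLength d)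
      - R.dartSlope ℓ k x d * cos (k * ℓ.dartLength d) := by
  rcases R.exists_up d with ⟨v, rfl⟩ | ⟨v, rfl⟩
  · exact R.mesh_values_end hx v (hS _)
  · obtain ⟨h1, h2⟩ := R.mesh_values_end hx v (hS _)
    have h3 := cos_sq_add_sinScaled_sq k (ℓ.dartLength (R.up v))
    have e1 : (R.up v).symm.snd = v := rfl
    have e2 : (R.up v).symm.fst = R.par v := rfl
    rw [ℓ.dartLength_symm, SimpleGraph.Dart.symm_symm, e1, e2, h1, h2]
    constructor
    · linear_combination -x (node n a v) * h3
    · linear_combination -R.dartSlope ℓ k x (R.up v) * h3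

end Kernel

variable [Fintype V] [DecidableEq V]

/-- The eigenfunction with prescribed mesh values. -/
noncomputable def meshSolution (k : ℝ) :
    LinearMap.ker (treeOperator (R.meshPar n) (R.meshStep ℓ n) k).toLinearMap
      →ₗ[ℝ] (MetricGraph ℓ → ℝ) where
  toFun x := solution ℓ k (fun v => x.1 (node n a v)) (R.dartSlope ℓ k x.1)
  map_add' x y := by
    funext p
    have h : ∀ d, R.dartSlope ℓ k (x.1 + y.1) d
        = R.dartSlope ℓ k x.1 d + R.dartSlope ℓ k y.1 d := fun d => by
      rcases R.exists_up d with ⟨v, rfl⟩ | ⟨v, rfl⟩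
      · simp only [dartSlope_up, slopeUp_add]
      · simp only [dartSlope_up_symm, slopeDown_add]
    simp only [solution, Pi.add_apply, Submodule.coe_add, h, PiLp.add_apply]
    ring
  map_smul' r x := by
    funext p
    have h : ∀ d, R.dartSlope ℓ k (r • x.1) d = r * R.dartSlope ℓ k x.1 d := fun d => by
      rcases R.exists_up d with ⟨v, rfl⟩ | ⟨v, rfl⟩
      · simp only [dartSlope_up, slopeUp_smul]
      · simp only [dartSlope_up_symm, slopeDown_smul]
    simp only [solution, Pi.smul_apply, Submodule.coe_smul, h, PiLp.smul_apply, smul_eq_mul,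
      RingHom.id_apply]
    ring

/-- The value and slope at the lower end of an edge are read off at distance 0 and at one mesh step,
where `sinScaled` is nonzero; they determine the mesh values. The root value comes from an edge
ending there. -/
theorem meshSolution_injective (hroot : ∃ v : {v : V // v ≠ a}, R.par v = a) {k : ℝ}
    (hS : ∀ i, sinScaled k (R.meshStep ℓ n i) ≠ 0) :
    Function.Injective (R.meshSolution ℓ n k) := by
  rw [← LinearMap.ker_eq_bot, LinearMap.ker_eq_bot']
  rintro ⟨x, hx⟩ h0
  have hx' : treeOperator (R.meshPar n) (R.meshStep ℓ n) k x = 0 := hx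
  have hc := R.mesh_compatible hx' hS
  have hval : ∀ (d : G.Dart) (t : ℝ), t ∈ Set.Icc 0 (ℓ.dartLength d) →
      x (node n a d.fst) * cos (k * t) + R.dartSlope ℓ k x d * sinScaled k t = 0 := by
    intro d t ht
    rw [← onEdge_solution (c := fun v => x (node n a v)) (fun d => (hc d).1) (fun d => (hc d).2)
      d ht, onEdge]
    exact congrFun h0 _
  have hv : ∀ v : {v : V // v ≠ a}, x (node n a v) = 0 ∧ R.dartSlope ℓ k x (R.up v) = 0 := by
    intro v
    have h1 := hval (R.up v) 0 ⟨le_rfl, (ℓ.dartLength_pos _).le⟩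
    have h2 := hval (R.up v) (R.meshStep ℓ n (v, 0)) ⟨(R.meshStep_pos ℓ n _).le, by
      rw [meshStep]
      exact div_le_self (ℓ.dartLength_pos _).le (by linarith [Nat.cast_nonneg (α := ℝ) n])⟩
    simp only [mul_zero, cos_zero, mul_one, sinScaled_zero_right, add_zero] at h1
    rw [h1, zero_mul, zero_add] at h2
    exact ⟨h1, (mul_eq_zero.1 h2).resolve_right (hS _)⟩
  refine Subtype.ext (PiLp.ext fun w => ?_)
  change x w = 0
  rcases w with _ | ⟨v, m, hm⟩
  · obtain ⟨v, hva⟩ := hroot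
    have := (hc (R.up v)).1
    rw [R.up_snd, hva, node_root, R.up_fst, (hv v).1, (hv v).2] at this
    simpa using this
  · rw [(R.mesh_values hx' v (hS _) hm).1, ← node_val n v, (hv v).1, (hv v).2]
    ring

/-- There are at least `j + 1` eigenvalues up to `K²` as soon as
`K L ≥ (j - 1 + p / 2) π`. -/
theorem le_rank_eigenspan [DecidableRel G.Adj] (hG : G.IsTree) (ha : G.degree a = 1) {j : ℕ}
    {K : ℝ} (hK : 0 < K)
    (h : ((j : ℝ) - 1 + (leafCount G : ℝ) / 2) * π ≤ K * ℓ.totalLength) :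
    ((j + 1 : ℕ) : Cardinal) ≤ Module.rank ℝ (eigenspan ℓ (Set.Iic (K ^ 2))) := by
  obtain ⟨R⟩ := exists_rooting hG a
  have hroot : ∃ v : {v : V // v ≠ a}, R.par v = a := by
    rw [R.degree_eq, if_neg (by simp), zero_add] at ha
    obtain ⟨v, hv⟩ := Finset.card_pos.1 (ha ▸ one_pos)
    exact ⟨v, by simpa using hv⟩
  -- More than K L pieces per edge give K h < 1 < π on each piece.
  obtain ⟨n, hn⟩ := exists_nat_gt (K * ℓ.totalLength)
  have hstep : ∀ i, K * R.meshStep ℓ n i < π := by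
    intro i
    have h1 : ℓ.dartLength (R.up i.1) ≤ ℓ.totalLength := by
      rw [R.totalLength_eq]
      exact Finset.single_le_sum (f := fun v => ℓ.dartLength (R.up v))
        (fun v _ => (ℓ.dartLength_pos _).le) (Finset.mem_univ i.1)
    have h2 : K * ℓ.dartLength (R.up i.1) ≤ K * ℓ.totalLength := by gcongr
    have h3 : (0 : ℝ) < n + 1 := by positivity
    rw [meshStep, mul_div_assoc', div_lt_iff₀ h3]
    nlinarith [pi_gt_three]
  -- The mesh has p - 1 leaves below the root, so the required angle is (j + (p - 2)/2)π, which is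
  -- the bound in `h`.
  have hcard := R.card_mesh_leaves n ha
  obtain ⟨S, hS, hle⟩ := exists_finset_sum_finrank_ker_treeOperator (R.meshPar n)
    (R.meshStep ℓ n) (R.meshPar_wellFounded n)
    (by
      obtain ⟨v, hv⟩ := hroot
      exact ⟨(v, Fin.last n), by rw [meshPar_last, hv, node_root]⟩)
    hK (R.meshStep_pos ℓ n) hstep j (by
      rw [R.sum_meshStep]
      refine le_trans (le_of_eq ?_) h
      rw [← hcard]
      push_cast
      ring)
  have hS0 : ∀ k ∈ S, ∀ i, sinScaled k (R.meshStep ℓ n i) ≠ 0 := fun k hk i =>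
    (sinScaled_pos (hS k hk).1 (R.meshStep_pos ℓ n i) (lt_of_le_of_lt
      (mul_le_mul_of_nonneg_right (hS k hk).2 (R.meshStep_pos ℓ n i).le) (hstep i))).ne'
  refine le_trans (Nat.cast_le.2 hle) (sum_finrank_le_rank_eigenspan hS (R.meshSolution ℓ n)
    (fun k hk => R.meshSolution_injective ℓ n hroot (hS0 k hk)) fun k hk x => ?_)
  have hx : treeOperator (R.meshPar n) (R.meshStep ℓ n) k x.1 = 0 := x.2
  have hc := R.mesh_compatible hx (hS0 k hk)
  exact solution_solvesNeumann (ℓ := ℓ) (c := fun v => x.1 (node n a v)) (fun d => (hc d).1)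
    (fun d => (hc d).2)
    (R.sum_slope_node_eq_zero hx)

end Rooting

end QuantumGraph

/-! ### Nearly extremal metrics. -/

namespace QuantumGraph

open Real Set

theorem cot_le_inv {x : ℝ} (hx : 0 < x) (hx' : x < π / 2) : cot x ≤ x⁻¹ := by
  rw [← tan_inv_eq_cot]
  exact inv_anti₀ hx (le_tan hx.le hx')

theorem inv_le_cot_two_mul {x : ℝ} (hx : 0 < x) (hx' : x ≤ 1 / 4) : (4 * x)⁻¹ ≤ cot (2 * x) := by
  have hs : sin (2 * x) ≤ 2 * x := sin_le (by linarith)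
  have hc := one_sub_sq_div_two_le_cos (x := 2 * x)
  have hs0 : 0 < sin (2 * x) := sin_pos_of_pos_of_lt_pi (by linarith) (by linarith [pi_gt_three])
  rw [cot_eq_cos_div_sin, le_div_iff₀ hs0, inv_mul_le_iff₀ (by linarith)]
  nlinarith

/-- The inequality on an edge with a free end, zeros at `π/2, 3π/2, …, (m + 1/2) π`, and a
remaining part of length `b`. -/
theorem free_end_le_integral {u u' : ℝ → ℝ} {σ η b l : ℝ} {m : ℕ} (hb : 0 ≤ b)
    (hl : l = π / 2 + m * π + b)
    (hu : ∀ x ∈ Icc 0 l, HasDerivWithinAt u (u' x) (Icc 0 l) x) (hu' : ContinuousOn u' (Icc 0 l))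
    (hσ : 0 ≤ σ) (hσ1 : σ < 1) (hη : 0 < η) (hπ : σ * b + η < π)
    (h0 : ∀ i ≤ m, u (π / 2 + i * π) = 0) :
    σ ^ 2 * (∫ x in (0 : ℝ)..l, u x * u x) + σ * cot (σ * b + η) * u l ^ 2
      ≤ ∫ x in (0 : ℝ)..l, u' x * u' x := by
  have hpi := pi_pos
  have hm : (0 : ℝ) ≤ m * π := by positivity
  set t : ℕ → ℝ := fun i => π / 2 + i * π with ht
  have ht0 : t 0 = π / 2 := by simp [ht]
  have htm : t m = π / 2 + m * π := rfl
  have hs1 : Icc 0 (t 0) ⊆ Icc 0 l := Icc_subset_Icc le_rfl (by linarith)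
  have hs2 : Icc (t 0) (t m) ⊆ Icc 0 l := Icc_subset_Icc (by linarith) (by linarith)
  have hs3 : Icc (t m) l ⊆ Icc 0 l := Icc_subset_Icc (by linarith) le_rfl
  have huc : ContinuousOn u (Icc 0 l) := fun x hx => (hu x hx).continuousWithinAt
  have i1 : ∀ {v : ℝ → ℝ}, ContinuousOn v (Icc 0 l) → ∫ x in (0 : ℝ)..l, v x * v x
      = (∫ x in (0 : ℝ)..t 0, v x * v x) + (∫ x in t 0..t m, v x * v x)
        + ∫ x in t m..l, v x * v x := by
    intro v hv
    have hv2 : ContinuousOn (fun x => v x * v x) (Icc 0 l) := hv.mul hv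
    have j1 := (hv2.mono hs1).intervalIntegrable_of_Icc (μ := MeasureTheory.volume)
      (by linarith : (0 : ℝ) ≤ t 0)
    have j2 := (hv2.mono hs2).intervalIntegrable_of_Icc (μ := MeasureTheory.volume)
      (by linarith : t 0 ≤ t m)
    have j3 := (hv2.mono hs3).intervalIntegrable_of_Icc (μ := MeasureTheory.volume)
      (by linarith : t m ≤ l)
    rw [intervalIntegral.integral_add_adjacent_intervals j1 j2,
      intervalIntegral.integral_add_adjacent_intervals (j1.trans j2) j3]
  -- Since cot (π/2) = 0, this phase leaves no boundary term at the free end; σ < 1 keeps the phase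
  -- below π up to the first zero.
  have h1 := riccati_le_integral (η := π / 2) (by linarith : (0 : ℝ) ≤ t 0)
    (fun x hx => (hu x (hs1 hx)).mono hs1) (hu'.mono hs1) (by linarith) hσ (by nlinarith)
  have h2 := dirichlet_mesh_le_integral (t := t) (m := m)
    (fun i _ => by simp only [ht]; push_cast; linarith)
    (fun x hx => (hu x (hs2 hx)).mono hs2) (hu'.mono hs2) hσ
    (fun i _ => by simp only [ht]; push_cast; nlinarith) h0
  have hlm : l - t m = b := by linarith
  have h3 := riccati_le_integral (by linarith : t m ≤ l)
    (fun x hx => (hu x (hs3 hx)).mono hs3) (hu'.mono hs3) hη hσ (by rwa [hlm])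
  rw [hlm, h0 m le_rfl] at h3
  rw [h0 0 m.zero_le, cot_eq_cos_div_sin (π / 2), cos_pi_div_two] at h1
  simp only [ne_eq, OfNat.ofNat_ne_zero, not_false_eq_true, zero_pow, mul_zero, zero_div, zero_mul,
    sub_zero, add_zero] at h1 h3
  rw [i1 huc, i1 hu', mul_add, mul_add]
  linarith

namespace Rooting

variable {V : Type*} {G : SimpleGraph V} {a : V} (R : Rooting G a)

/-- The metric in which the edge from `v` to its parent has length `len v`. -/
noncomputable def metric (len : {v : V // v ≠ a} → ℝ) (h : ∀ v, 0 < len v) : EdgeMetric G where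
  length e := len (R.edgeEquiv.symm e)
  length_pos _ := h _

theorem dartLength_metric (len : {v : V // v ≠ a} → ℝ) (h : ∀ v, 0 < len v)
    (v : {v : V // v ≠ a}) : (R.metric len h).dartLength (R.up v) = len v := by
  have : R.edgeEquiv.symm ⟨(R.up v).edge, (R.up v).edge_mem⟩ = v :=
    R.edgeEquiv.symm_apply_apply v
  simp only [EdgeMetric.dartLength, metric, this]

variable [Fintype V] [DecidableEq V]

/-- Phases grow by the factor 4|V| per step away from the root. A vertex has at most |V| children,
each with cotangent at most 1/(4|V| η v), so the sum is at most 1/(4 η v) ≤ cot(2 η v). -/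
theorem exists_phase {σ : ℝ} (hσ1 : σ < 1) :
    ∃ η : V → ℝ, (∀ v, 0 < η v ∧ η v ≤ 1 / 4 ∧ η v ≤ (1 - σ) * (π / 2)) ∧
      ∀ v : {v : V // v ≠ a}, ∑ c : {v : V // v ≠ a} with R.par c.1 = v.1, cot (η c)
        ≤ cot (2 * η v) := by
  set Q : ℝ := 4 * Fintype.card V with hQ
  have hcard : (1 : ℝ) ≤ Fintype.card V := by
    have : Nonempty V := ⟨a⟩
    exact_mod_cast Fintype.card_pos
  have hQ1 : 1 ≤ Q := by linarith
  set N := ∑ v, G.dist a v with hN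
  have hdN : ∀ v, G.dist a v ≤ N := fun v =>
    Finset.single_le_sum (f := fun v => G.dist a v) (fun _ _ => Nat.zero_le _) (Finset.mem_univ v)
  set M : ℝ := min (1 / 4) ((1 - σ) * (π / 2)) with hM
  have hM0 : 0 < M := lt_min (by norm_num) (mul_pos (by linarith) (by linarith [pi_pos]))
  have hη0 : ∀ v, 0 < M / Q ^ N * Q ^ G.dist a v := fun v => by positivity
  have hηM : ∀ v, M / Q ^ N * Q ^ G.dist a v ≤ M := fun v => by
    rw [div_mul_eq_mul_div, div_le_iff₀ (by positivity)]
    exact mul_le_mul_of_nonneg_left (pow_le_pow_right₀ hQ1 (hdN v)) hM0.le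
  have hη1 : ∀ v, M / Q ^ N * Q ^ G.dist a v ≤ 1 / 4 := fun v => (hηM v).trans (min_le_left _ _)
  refine ⟨fun v => M / Q ^ N * Q ^ G.dist a v,
    fun v => ⟨hη0 v, hη1 v, (hηM v).trans (min_le_right _ _)⟩, fun v => ?_⟩
  refine le_trans ?_ (inv_le_cot_two_mul (hη0 v) (hη1 v))
  calc ∑ c : {v : V // v ≠ a} with R.par c.1 = v.1, cot (M / Q ^ N * Q ^ G.dist a c)
      ≤ ∑ c : {v : V // v ≠ a} with R.par c.1 = v.1, (M / Q ^ N * Q ^ G.dist a v * Q)⁻¹ := by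
        refine Finset.sum_le_sum fun c hc => ?_
        have h1 := cot_le_inv (hη0 c) (by linarith [hη1 c, pi_gt_three])
        have h2 : M / Q ^ N * Q ^ G.dist a c = M / Q ^ N * Q ^ G.dist a v * Q := by
          rw [R.dist c c.2, (Finset.mem_filter.1 hc).2, pow_succ, ← mul_assoc]
        rwa [h2] at h1 ⊢
    _ ≤ Fintype.card V * (M / Q ^ N * Q ^ G.dist a v * Q)⁻¹ := by
        rw [Finset.sum_const, nsmul_eq_mul]
        have : ((Finset.univ.filter fun c : {v : V // v ≠ a} => R.par c.1 = v.1).card : ℝ)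
            ≤ Fintype.card V := by
          exact_mod_cast (Finset.card_le_univ _).trans (Fintype.card_subtype_le _)
        gcongr
    _ = (4 * (M / Q ^ N * Q ^ G.dist a v))⁻¹ := by
        have := (hη0 v).ne'
        rw [hQ]
        field_simp

/-- Metrics for which the eigenvalue with index `j` is at least `σ²`, where `σ < 1`: the pendant
edges have length `π / 2`, except for the one at the root, which is longer by a multiple of `π`,
and the inner edges are very short. -/
theorem exists_metric_rank_le [DecidableRel G.Adj] (hG : G.IsTree) (ha : G.degree a = 1)
    {σ : ℝ} (hσ : 0 < σ) (hσ1 : σ < 1) (m : ℕ) :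
    ∃ ℓ : EdgeMetric G, ((m : ℝ) + (leafCount G : ℝ) / 2) * π ≤ ℓ.totalLength ∧
      Module.rank ℝ (eigenspan ℓ (Iio (σ ^ 2))) ≤ ((m + 1 : ℕ) : Cardinal) := by
  have hpi := pi_pos
  obtain ⟨R⟩ := exists_rooting hG a
  obtain ⟨η, hη, hsum⟩ := R.exists_phase hσ1
  -- On an inner edge the phase runs from η to 2η, as `exists_phase` expects. On a pendant edge it
  -- ends at σπ/2 + η ≤ π/2, where the cotangent is nonnegative.
  let base : {v : V // v ≠ a} → ℝ := fun v => if G.degree v.1 = 1 then π / 2 else η v / σ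
  have hbase : ∀ v, 0 < base v := fun v => by
    simp only [base]
    split_ifs
    · linarith
    · exact div_pos (hη v).1 hσ
  let len : {v : V // v ≠ a} → ℝ := fun v =>
    (if R.par v.1 = a then π / 2 + m * π else 0) + base v
  have hlen : ∀ v, 0 < len v := fun v => by
    have := hbase v
    simp only [len]
    split_ifs <;> positivity
  have hend : ∀ v, σ * base v + η v < π := fun v => by
    obtain ⟨_, h2, h3⟩ := hη v.1
    simp only [base]
    split_ifs
    · nlinarith
    · rw [mul_div_cancel₀ _ hσ.ne']
      linarith [pi_gt_three]
  have hvert : ∀ v : {v : V // v ≠ a}, ∑ c : {v : V // v ≠ a} with R.par c.1 = v.1, cot (η c)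
      ≤ cot (σ * base v + η v) := fun v => by
    by_cases hv : G.degree v.1 = 1
    · have h0 : (Finset.univ.filter fun c : {v : V // v ≠ a} => R.par c.1 = v.1) = ∅ :=
        Finset.filter_eq_empty_iff.2 fun c _ => (R.degree_eq_one_iff v.2).1 hv c c.2
      obtain ⟨h1, _, h3⟩ := hη v.1
      rw [h0, Finset.sum_empty, cot_eq_cos_div_sin]
      simp only [base, if_pos hv]
      have h4 : 0 < σ * (π / 2) := by positivity
      exact div_nonneg (cos_nonneg_of_neg_pi_div_two_le_of_le (by linarith) (by linarith))
        (sin_nonneg_of_nonneg_of_le_pi (by linarith) (by linarith))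
    · refine (hsum v).trans (le_of_eq ?_)
      simp only [base, if_neg hv]
      rw [mul_div_cancel₀ _ hσ.ne', two_mul]
  have hroot : (Finset.univ.filter fun v : {v : V // v ≠ a} => R.par v.1 = a).card = 1 := by
    have := R.degree_eq a
    rw [ha, if_neg (by simp), zero_add] at this
    exact this.symm
  obtain ⟨b, hb⟩ := Finset.card_eq_one.1 hroot
  have hba : R.par b = a := by
    have : b ∈ Finset.univ.filter fun v : {v : V // v ≠ a} => R.par v.1 = a := by
      rw [hb]
      exact Finset.mem_singleton_self b
    simpa using this
  have hbu : ∀ v : {v : V // v ≠ a}, R.par v = a → v = b := fun v hv => by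
    have : v ∈ Finset.univ.filter fun v : {v : V // v ≠ a} => R.par v.1 = a := by simpa using hv
    rw [hb] at this
    exact Finset.mem_singleton.1 this
  have hlenb : len b = π / 2 + m * π + base b := by simp only [len, if_pos hba]
  set ℓ := R.metric len hlen with hℓ
  have hdl : ∀ v, ℓ.dartLength (R.up v) = len v := R.dartLength_metric len hlen
  have hdl' : ∀ v, ℓ.dartLength (R.up v).symm = len v := fun v => by
    rw [ℓ.dartLength_symm, hdl]
  have hpt : ∀ i ≤ m, π / 2 + (i : ℝ) * π ∈ Icc 0 (ℓ.dartLength (R.up b).symm) := by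
    intro i hi
    rw [hdl', hlenb]
    have h1 : (i : ℝ) * π ≤ m * π := by gcongr
    exact ⟨by positivity, by linarith [hbase b]⟩
  refine ⟨ℓ, ?_, ?_⟩
  · rw [R.totalLength_eq, Finset.sum_congr rfl fun v _ => hdl v, Finset.sum_add_distrib,
      ← Finset.sum_filter, hb, Finset.sum_singleton, leafCount_eq ha]
    have h1 : ∑ v : {v : V // v ≠ a} with G.degree v.1 = 1, π / 2 ≤ ∑ v, base v := by
      rw [Finset.sum_filter]
      refine Finset.sum_le_sum fun v _ => ?_
      split_ifs with hv
      · simp only [base, if_pos hv, le_refl]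
      · exact (hbase v).le
    rw [Finset.sum_const, nsmul_eq_mul] at h1
    push_cast
    linarith
  · refine (rank_eigenspan_le (ι := Fin (m + 1)) (fun i => MetricGraph.mk
      ⟨(R.up b).symm, ⟨_, hpt i (by omega)⟩⟩) fun f f' hf h0 => ?_).trans (by simp)
    obtain ⟨c, hc⟩ := exists_vertex_value f
    have hstart : ∀ v, onEdge f (R.up v).symm 0 = c (R.par v) := fun v => hc _
    have hfin : ∀ v, onEdge f (R.up v).symm (len v) = c v := fun v => by
      have := onEdge_symm f (R.up v) (x := 0) ⟨le_rfl, (ℓ.dartLength_pos _).le⟩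
      rw [sub_zero, hdl] at this
      rw [this]
      exact hc _
    -- Edges are traversed away from the root, with phase η v at the parent end; the root edge has a
    -- free end and no boundary term there.
    have hedge : ∀ v, σ ^ 2 * (∫ x in (0 : ℝ)..len v,
        onEdge f (R.up v).symm x * onEdge f (R.up v).symm x)
        + σ * (cot (σ * base v + η v) * c v ^ 2
          - if R.par v.1 = a then 0 else cot (η v) * c (R.par v) ^ 2)
        ≤ ∫ x in (0 : ℝ)..len v, f' (R.up v).symm x * f' (R.up v).symm x := by
      intro v
      have hu := hf.hasDeriv (R.up v).symm
      have hu' := hf.continuousOn (R.up v).symm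
      rw [hdl'] at hu hu'
      by_cases hv : R.par v.1 = a
      · obtain rfl := hbu v hv
        have := free_end_le_integral (hbase v).le hlenb hu hu' hσ.le hσ1 (hη v).1 (hend v)
          fun i hi => by
            rw [onEdge_apply f _ (hpt i hi)]
            exact h0 ⟨i, by omega⟩
        rw [hfin] at this
        rw [if_pos hv]
        linarith
      · have hl : len v = base v := by simp only [len, if_neg hv, zero_add]
        have := riccati_le_integral (hlen v).le hu hu' (hη v).1 hσ.le (by
          rw [sub_zero, hl]
          exact hend v)
        rw [hfin, hstart, sub_zero] at this
        rw [if_neg hv]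
        rw [hl] at this ⊢
        linarith
    -- Grouped by vertices, the coefficient of c v ^ 2 is the difference of the two sides of
    -- `hvert`.
    have hbdry : 0 ≤ ∑ v : {v : V // v ≠ a}, (cot (σ * base v + η v) * c v ^ 2
        - if R.par v.1 = a then 0 else cot (η v) * c (R.par v) ^ 2) := by
      have h1 : ∑ v : {v : V // v ≠ a}, (if R.par v.1 = a then 0
          else cot (η v) * c (R.par v) ^ 2)
          = ∑ w : {v : V // v ≠ a}, ∑ v : {v : V // v ≠ a} with R.par v.1 = w.1,
            cot (η v) * c w ^ 2 := by
        simp only [Finset.sum_filter]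
        rw [Finset.sum_comm]
        refine Finset.sum_congr rfl fun v _ => ?_
        split_ifs with hv
        · symm
          exact Finset.sum_eq_zero fun w _ => if_neg fun h : R.par v.1 = w.1 => w.2 (h.symm.trans hv)
        · rw [Finset.sum_eq_single_of_mem (⟨R.par v, hv⟩ : {v : V // v ≠ a}) (Finset.mem_univ _)
            fun w _ hw => if_neg fun h => hw (Subtype.ext h.symm)]
          simp
      rw [Finset.sum_sub_distrib, h1, ← Finset.sum_sub_distrib]
      refine Finset.sum_nonneg fun w _ => ?_
      rw [← Finset.sum_mul, ← sub_mul]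
      exact mul_nonneg (sub_nonneg.2 (hvert w)) (sq_nonneg _)
    have htot := Finset.sum_le_sum fun v (_ : v ∈ Finset.univ) => hedge v
    rw [Finset.sum_add_distrib, ← Finset.mul_sum, ← Finset.mul_sum] at htot
    have hσb := mul_nonneg hσ.le hbdry
    rw [edgeInner, R.sum_darts, R.sum_darts, Finset.sum_congr rfl fun v _ =>
      integral_onEdge_symm f (R.up v), Finset.sum_congr rfl fun v _ => hf.integral_symm (R.up v)]
    simp only [hdl']
    linarith

end Rooting

end QuantumGraph

/-! ### Existence of the indexed eigenvalue, and the conclusion. -/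

namespace QuantumGraph

open Set

section Existence

variable {V : Type*} {G : SimpleGraph V} [Fintype V] [DecidableEq V] [DecidableRel G.Adj]
  {ℓ : EdgeMetric G}

/-- A common nonzero element would have Rayleigh quotient both equal to lam and less than lam. -/
theorem eigenspace_inf_eigenspan_Iio (lam : ℝ) :
    eigenspace ℓ lam ⊓ eigenspan ℓ (Iio lam) = ⊥ := by
  rw [Submodule.eq_bot_iff]
  rintro f ⟨hf, hf'⟩
  by_contra h0
  obtain ⟨f', hd, hlt⟩ := exists_energy_lt hf' h0
  obtain ⟨g', hg, hE⟩ := SolvesNeumann.exists_hasEdgeDeriv hf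
  rw [← hE f f' hd] at hlt
  refine hlt.ne (Finset.sum_congr rfl fun d _ => intervalIntegral.integral_congr fun x hx => ?_)
  have hl := ℓ.dartLength_pos d
  rw [uIcc_of_le hl.le] at hx
  simp only [(uniqueDiffOn_Icc hl x hx).eq_deriv _ (hd.hasDeriv d x hx) (hg.hasDeriv d x hx)]

theorem eigenspan_mono {S T : Set ℝ} (h : S ⊆ T) : eigenspan ℓ S ≤ eigenspan ℓ T :=
  biSup_mono fun _ hx => h hx

theorem eigenspace_le_eigenspan {S : Set ℝ} {lam : ℝ} (h : lam ∈ S) :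
    eigenspace ℓ lam ≤ eigenspan ℓ S :=
  le_iSup₂ (f := fun lam (_ : lam ∈ S) => eigenspace ℓ lam) lam h

theorem finiteDimensional_eigenspan_Iic (B : ℝ) : FiniteDimensional ℝ (eigenspan ℓ (Iic B)) :=
  Module.rank_lt_aleph0_iff.1 <| (Submodule.rank_mono (eigenspan_mono fun _ hx =>
    lt_of_le_of_lt hx (lt_add_one B))).trans_lt (rank_eigenspan_Iio_lt_aleph0 ℓ (B + 1))

/-- Each eigenvalue strictly raises the dimension of the span up to it, and these dimensions are
bounded by the one at B. -/
theorem finite_eigenvalues (B : ℝ) : {lam | lam ≤ B ∧ eigenspace ℓ lam ≠ ⊥}.Finite := by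
  have := finiteDimensional_eigenspan_Iic (ℓ := ℓ)
  let r : ℝ → ℕ := fun lam => Module.finrank ℝ (eigenspan ℓ (Iic lam))
  have hmono : Monotone r := fun x y h =>
    Submodule.finrank_mono (eigenspan_mono (Iic_subset_Iic.2 h))
  have hstrict : ∀ x y, x < y → eigenspace ℓ y ≠ ⊥ → r x < r y := by
    intro x y hxy hy
    refine Submodule.finrank_lt_finrank_of_lt (lt_of_le_of_ne
      (eigenspan_mono (Iic_subset_Iic.2 hxy.le)) fun h => hy ?_)
    rw [← le_bot_iff, ← eigenspace_inf_eigenspan_Iio y]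
    refine le_inf le_rfl ((eigenspace_le_eigenspan (S := Iic y) self_mem_Iic).trans ?_)
    rw [← h]
    exact eigenspan_mono fun z hz => lt_of_le_of_lt hz hxy
  refine Finite.of_finite_image (f := r) ((finite_Iic (r B)).subset ?_) ?_
  · rintro _ ⟨x, hx, rfl⟩
    exact hmono hx.1
  · intro x hx y hy hxy
    rcases lt_trichotomy x y with h | h | h
    · exact absurd hxy (hstrict x y h hy.2).ne
    · exact h
    · exact absurd hxy (hstrict y x h hx.2).ne'

theorem eigenspan_eq_bot_or_le {S : Set ℝ} {B : ℝ} (hS : S ⊆ Iic B) :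
    eigenspan ℓ S = ⊥ ∨
      ∃ mu ∈ S, eigenspace ℓ mu ≠ ⊥ ∧ eigenspan ℓ S ≤ eigenspan ℓ (Iic mu) := by
  have hfin : {lam | lam ∈ S ∧ eigenspace ℓ lam ≠ ⊥}.Finite :=
    (finite_eigenvalues B).subset fun x hx => ⟨hS hx.1, hx.2⟩
  rcases eq_empty_or_nonempty {lam | lam ∈ S ∧ eigenspace ℓ lam ≠ ⊥} with h | h
  · left
    rw [eigenspan, iSup₂_eq_bot]
    intro x hx
    by_contra hne
    exact eq_empty_iff_forall_notMem.1 h x ⟨hx, hne⟩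
  · right
    obtain ⟨mu, hmu, hmax⟩ := exists_max_image _ id hfin h
    refine ⟨mu, hmu.1, hmu.2, iSup₂_le fun x hx => ?_⟩
    by_cases hne : eigenspace ℓ x = ⊥
    · rw [hne]
      exact bot_le
    · exact eigenspace_le_eigenspan (hmax x ⟨hx, hne⟩)

/-- Take the least eigenvalue t whose span up to t has dimension at least j + 1. The span strictly
below t is zero or reached at a smaller eigenvalue, so by minimality its dimension is at most j. -/
theorem exists_isEigenvalueAt {j : ℕ} {B : ℝ}
    (h : ((j + 1 : ℕ) : Cardinal) ≤ Module.rank ℝ (eigenspan ℓ (Iic B))) :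
    ∃ t, IsEigenvalueAt ℓ j t ∧ t ≤ B := by
  let A : Set ℝ := {lam | (lam ≤ B ∧ eigenspace ℓ lam ≠ ⊥) ∧
    ((j + 1 : ℕ) : Cardinal) ≤ Module.rank ℝ (eigenspan ℓ (Iic lam))}
  have hA : A.Finite := (finite_eigenvalues B).subset fun x hx => hx.1
  have hA' : A.Nonempty := by
    rcases eigenspan_eq_bot_or_le (ℓ := ℓ) (S := Iic B) le_rfl with h0 | ⟨mu, hmu, hne, hle⟩
    · rw [h0, rank_bot] at h
      simp at h
    · exact ⟨mu, ⟨hmu, hne⟩, h.trans (Submodule.rank_mono hle)⟩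
  obtain ⟨t, ht, hmin⟩ := exists_min_image A id hA hA'
  refine ⟨t, ⟨?_, ht.2⟩, ht.1.1⟩
  rcases eigenspan_eq_bot_or_le (ℓ := ℓ) (S := Iio t) Iio_subset_Iic_self with
    h0 | ⟨mu, hmu, hne, hle⟩
  · rw [h0, rank_bot]
    exact zero_le
  · refine (Submodule.rank_mono hle).trans ?_
    by_contra! hlt
    have hle' : ((j + 1 : ℕ) : Cardinal) ≤ Module.rank ℝ (eigenspan ℓ (Iic mu)) := by
      rw [Nat.cast_add_one]
      exact Cardinal.add_one_le_of_lt hlt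
    exact absurd (hmin mu ⟨⟨(le_of_lt hmu).trans ht.1.1, hne⟩, hle'⟩) (not_le.2 hmu)

end Existence

/-- The sharp upper constant of a tree. -/
theorem isSharpUpperConstant_of_isTree {V : Type*} [Fintype V] [DecidableEq V] (G : SimpleGraph V)
    [DecidableRel G.Adj] (hG : G.IsTree) (hE : G.edgeSet.Nonempty) (j : ℕ) (hj : 1 ≤ j) :
    IsSharpUpperConstant G j
      (((j : ℝ) - 1 + (leafCount G : ℝ) / 2) ^ 2 * Real.pi ^ 2) := by
  have hpi := Real.pi_pos
  have hnt : Nontrivial V := by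
    obtain ⟨e, he⟩ := hE
    induction e with
    | h x y => exact ⟨x, y, G.ne_of_adj he⟩
  obtain ⟨a, ha⟩ := hG.exists_vert_degree_one_of_nontrivial
  have hj1 : (1 : ℝ) ≤ j := by exact_mod_cast hj
  have hp : (1 : ℝ) ≤ leafCount G := by
    rw [Rooting.leafCount_eq ha]
    push_cast
    linarith [Nat.cast_nonneg (α := ℝ) (Finset.univ.filter
      fun v : {v : V // v ≠ a} => G.degree v.1 = 1).card]
  set X : ℝ := (j : ℝ) - 1 + (leafCount G : ℝ) / 2 with hX
  have hX0 : 0 < X := by linarith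
  constructor
  · intro ℓ
    have hL : 0 < ℓ.totalLength :=
      Finset.sum_pos (fun e _ => ℓ.length_pos e) ⟨⟨_, hE.some_mem⟩, Finset.mem_univ _⟩
    obtain ⟨t, ht, hle⟩ := exists_isEigenvalueAt (Rooting.le_rank_eigenspan ℓ hG ha (j := j)
      (K := X * Real.pi / ℓ.totalLength) (by positivity) (by
        rw [div_mul_cancel₀ _ hL.ne']))
    exact ⟨t, ht, by rwa [div_pow, mul_pow] at hle⟩
  · intro c hc
    by_contra! hlt
    have hC : 0 < X ^ 2 * Real.pi ^ 2 := by positivity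
    -- A smaller constant c fails for σ = √r with c/(X²π²) < r < 1 and m = j - 1. The maximum with 0
    -- is there because c may be negative.
    obtain ⟨r, hr, hr1⟩ := exists_between (max_lt ((div_lt_one hC).2 hlt) one_pos)
    have hr0 : 0 < r := lt_of_le_of_lt (le_max_right _ _) hr
    have hcr : c < r * (X ^ 2 * Real.pi ^ 2) :=
      (div_lt_iff₀ hC).1 (lt_of_le_of_lt (le_max_left _ _) hr)
    obtain ⟨ℓ, hL, hrank⟩ := Rooting.exists_metric_rank_le hG ha (Real.sqrt_pos.2 hr0)
      (by rw [Real.sqrt_lt' one_pos, one_pow]; exact hr1) (j - 1)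
    rw [Real.sq_sqrt hr0.le, Nat.sub_add_cancel hj] at hrank
    rw [Nat.cast_sub hj, Nat.cast_one, ← hX] at hL
    obtain ⟨t, ht, htc⟩ := hc ℓ
    have hrt : r ≤ t := by
      by_contra! h
      have h1 := ht.2.trans ((Submodule.rank_mono (eigenspan_mono fun x hx =>
        lt_of_le_of_lt hx h)).trans hrank)
      have h2 : j + 1 ≤ j := Nat.cast_le.1 h1
      omega
    have hXp : 0 < X * Real.pi := by positivity
    have hL0 : 0 < ℓ.totalLength := hXp.trans_le hL
    have h1 : r * ℓ.totalLength ^ 2 ≤ c := (le_div_iff₀ (by positivity)).1 (hrt.trans htc)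
    have h2 : (X * Real.pi) ^ 2 ≤ ℓ.totalLength ^ 2 := pow_le_pow_left₀ hXp.le hL 2
    rw [mul_pow] at h2
    nlinarith

end QuantumGraph

theorem theorem1p1 {V : Type*} [Fintype V] [DecidableEq V] (G : SimpleGraph V)
    [DecidableRel G.Adj] (hG : G.IsTree) (hE : G.edgeSet.Nonempty) (j : ℕ) (hj : 1 ≤ j) :
    QuantumGraph.IsSharpUpperConstant G j
      (((j : ℝ) - 1 + (QuantumGraph.leafCount G : ℝ) / 2) ^ 2 * Real.pi ^ 2) :=
  QuantumGraph.isSharpUpperConstant_of_isTree G hG hE j hj
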